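/- Let $k$ be a commutative ring and let $H$ be a Hopf algebra over $k$ (comultiplication $\Delta$, counit $\varepsilon$) which is a $k$-progenerator, i.e. finitely generated, projective and faithful as a $k$-module. Let $A$ be a right $H$-comodule algebra: an associative unital $k$-algebra with a coassociative, counital right coaction $\rho: A\to A\otimes H$, $\rho(a)=a_{[0]}\otimes a_{[1]}$, that is a $k$-algebra homomorphism. Unadorned tensor products, duals and endomorphisms are over $k$. Notation. - $A^{{\rm co}H}=\{a\in A \mid \rho(a)=a\otimes 1\}$, and "$A^{{\rm co}H}=k$" means that the structure map $k\to A^{{\rm co}H}$ is bijective. - ${\rm can}': A\otimes A\to A\otimes H$, ${\rm can}'(a'\otimes a)=a'a_{[0]}\otimes a_{[1]}$. - $H^*={\rm Hom}(H,k)$ has the convolution product $\langle p*q,h\rangle=\langle p,h_{(1)}\rangle\langle q,h_{(2)}\rangle$ and the coproduct determined by $\langle p,hg\rangle=\langle p_{(1)},h\rangle\langle p_{(2)},g\rangle$; it acts on $A$ by $h^*\rightharpoonup a=\langle h^*,a_{[1]}\rangle a_{[0]}$. - $H^*\# A$ is the $k$-module $H^*\otimes A$ with product $(h^*\# a)(k^*\#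 b)=(k^*_{(1)}*h^*)\#(k^*_{(2)}\rightharpoonup a)b$ and unit $\varepsilon\# 1$. - ${}^*{\rm can}': H^*\# A\to {\rm End}(A)^{\rm op}$, ${}^*{\rm can}'(h^*\# a)(b)=(h^*\rightharpoonup b)a$, is an algebra homomorphism, through which $A$ is a right $H^*\# A$-module: $a\cdot y={}^*{\rm can}'(y)(a)$. - $Q=\{y\in H^*\# A \mid y(h^*\# 1)=\langle h^*,1\rangle y \text{ for all } h^*\in H^*\}$, a left ideal of $H^*\# A$. - If $A^{{\rm co}H}=k$, there is a Morita context $(k,H^*\# A,A,Q,\tau,\mu)$ with $\tau: A\otimes_{H^*\# A}Q\to A^{{\rm co}H}=k$, $\tau(a\otimes y)={}^*{\rm can}'(y)(a)$, and $\mu: Q\otimes A\to H^*\# A$, $\mu(y\otimes a)=y(\varepsilon\# a)$. It is called strict if $\tau$ and $\mu$ are isomorphisms. - $\mathcal{M}_k$ is the category of $k$-modules. $\mathcal{M}_A^H$ is the category of relative Hopf modules: $k$-modules $M$ with a $k$-bilinear right $A$-action and a coassociative, counital $k$-linear right $H$-coaction such that $\rho(ma)=m_{[0]}a_{[0]}\otimes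 m_{[1]}a_{[1]}$; morphisms are the right $A$-linear, right $H$-colinear maps. - $F=\bullet\otimes A:\mathcal{M}_k\to\mathcal{M}_A^H$, where $(n\otimes b)a=n\otimes ba$ and $\rho(n\otimes b)=n\otimes b_{[0]}\otimes b_{[1]}$, is left adjoint to $G=(\bullet)^{{\rm co}H}$, $G(M)=\{m\in M\mid\rho(m)=m\otimes1\}$, with unit $n\mapsto n\otimes 1$ and counit $m\otimes a\mapsto ma$. Then the following statements are equivalent: 1. ${\rm can}'$ is bijective, and $A$ is faithfully flat as a $k$-module; 2. ${}^*{\rm can}'$ is an isomorphism, and $A$ is a $k$-progenerator; 3. $A^{{\rm co}H}=k$, and the Morita context $(k,H^*\# A,A,Q,\tau,\mu)$ is strict; 4. $A^{{\rm co}H}=k$, and the adjoint pair $(F,G)$ is an equivalence between $\mathcal{M}_k$ and $\mathcal{M}_A^H$, i.e. its unit and counit are isomorphisms. -/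

import Mathlib

open scoped TensorProduct

universe u v w

namespace HopfGalois

/-- A module over a commutative ring is a progenerator when it is finitely generated,
projective and faithful. -/
structure IsProgenerator (k : Type u) (M : Type v) [CommRing k] [AddCommGroup M] [Module k M] :
    Prop where
  finite : Module.Finite k M
  projective : Module.Projective k M
  faithful : FaithfulSMul k M

/-- A right `H`-comodule algebra: a `k`-algebra `A` with a coassociative and counital right
coaction `ρ : A → A ⊗ H`, `ρ a = a₀ ⊗ a₁`, which is a homomorphism of `k`-algebras. -/
class ComoduleAlgebra (k : Type u) (H : Type v) (A : Type w) [CommRing k] [Ring H]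
    [Bialgebra k H] [Ring A] [Algebra k A] where
  coaction : A →ₐ[k] A ⊗[k] H
  coassoc : ∀ a : A,
    TensorProduct.assoc k A H H (coaction.toLinearMap.rTensor H (coaction a)) =
      (Coalgebra.comul (R := k) (A := H)).lTensor A (coaction a)
  counit_coaction : ∀ a : A,
    TensorProduct.rid k A ((Coalgebra.counit (R := k) (A := H)).lTensor A (coaction a)) = a

section Tensor

variable (k : Type u) (H : Type v) (A : Type w) [CommRing k] [Ring H] [Bialgebra k H] [Ring A]
  [Algebra k A]

/-- The convolution product of `H*`: `⟨p * q, h⟩ = ⟨p, h₁⟩ ⟨q, h₂⟩`. -/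
noncomputable def conv (H : Type v) [Ring H] [Bialgebra k H] :
    Module.Dual k H →ₗ[k] Module.Dual k H →ₗ[k] Module.Dual k H :=
  LinearMap.mk₂ k
    (fun p q => LinearMap.mul' k k ∘ₗ TensorProduct.map p q ∘ₗ Coalgebra.comul)
    (fun p q a => by simp [TensorProduct.map_add_left, LinearMap.add_comp, LinearMap.comp_add])
    (fun c p a => by simp [TensorProduct.map_smul_left, LinearMap.smul_comp, LinearMap.comp_smul])
    (fun p a b => by simp [TensorProduct.map_add_right, LinearMap.add_comp, LinearMap.comp_add])
    (fun c p a => by simp [TensorProduct.map_smul_right, LinearMap.smul_comp, LinearMap.comp_smul])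

/-- Right translation `(g, p) ↦ p(- g)` on `H*`. For `H` finitely generated projective this is
`⟨p₂, g⟩ p₁`, where `p₁ ⊗ p₂` is the coproduct of `p`, that is `⟨p, h g⟩ = ⟨p₁, h⟩ ⟨p₂, g⟩`. -/
noncomputable def trans (H : Type v) [Ring H] [Bialgebra k H] :
    H →ₗ[k] Module.Dual k H →ₗ[k] Module.Dual k H :=
  LinearMap.mk₂ k (fun g p => p ∘ₗ LinearMap.mulRight k g)
    (fun g g' p => by ext; simp [mul_add])
    (fun c g p => by ext; simp)
    (fun g p q => by ext; simp)
    (fun c g p => by ext; simp)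

/-- The underlying `k`-module `H* ⊗ A` of the smash product `H* # A`. -/
def Smash (k : Type u) (H : Type v) (A : Type w) [CommRing k] [Ring H] [Bialgebra k H] [Ring A]
    [Algebra k A] : Type (max (max u v) w) :=
  Module.Dual k H ⊗[k] A

noncomputable instance : AddCommGroup (Smash k H A) :=
  inferInstanceAs (AddCommGroup (Module.Dual k H ⊗[k] A))

noncomputable instance : Module k (Smash k H A) :=
  inferInstanceAs (Module k (Module.Dual k H ⊗[k] A))

variable {H A} in
/-- The element `h* # a` of `H* # A`. -/
def Smash.mk (p : Module.Dual k H) (a : A) : Smash k H A := p ⊗ₜ[k] a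

variable {k H A} in
theorem Smash.induction {P : Smash k H A → Prop} (zero : P 0)
    (mk : ∀ p a, P (Smash.mk k p a)) (add : ∀ x y, P x → P y → P (x + y)) (x : Smash k H A) :
    P x :=
  TensorProduct.induction_on (motive := P) x zero mk add

/-- `convRight p (q # b) = (q * p) # b`. -/
noncomputable def convRight :
    Module.Dual k H →ₗ[k] Smash k H A →ₗ[k] Smash k H A :=
  (LinearMap.rTensorHom A : _ →ₗ[k] (Module.Dual k H ⊗[k] A →ₗ[k] Module.Dual k H ⊗[k] A)) ∘ₗ
    (conv k H).flip

/-- The action of `A ⊗ H` on `H* ⊗ A` given by `(a ⊗ g) (q # b) = q(- g) # a b`. -/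
noncomputable def twist : A ⊗[k] H →ₗ[k] Smash k H A →ₗ[k] Smash k H A :=
  (TensorProduct.map₂ (trans k H) (LinearMap.mul k A) :
    H ⊗[k] A →ₗ[k] Module.Dual k H ⊗[k] A →ₗ[k] Module.Dual k H ⊗[k] A) ∘ₗ
    (TensorProduct.comm k A H).toLinearMap

variable {k H A}

theorem conv_apply (p q : Module.Dual k H) (h : H) :
    conv k H p q h = LinearMap.mul' k k (TensorProduct.map p q (Coalgebra.comul h)) := rfl

@[simp] theorem trans_apply (g : H) (p : Module.Dual k H) (h : H) :
    trans k H g p h = p (h * g) := rfl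

@[simp] theorem convRight_mk (p q : Module.Dual k H) (b : A) :
    convRight k H A p (Smash.mk k q b) = Smash.mk k (conv k H q p) b := rfl

@[simp] theorem twist_tmul_mk (a : A) (g : H) (q : Module.Dual k H) (b : A) :
    twist k H A (a ⊗ₜ g) (Smash.mk k q b) = Smash.mk k (trans k H g q) (a * b) := rfl

theorem conv_assoc (p q r : Module.Dual k H) :
    conv k H (conv k H p q) r = conv k H p (conv k H q r) := by
  have := mul_assoc (WithConv.toConv p) (WithConv.toConv q) (WithConv.toConv r)
  exact congrArg WithConv.ofConv this

theorem conv_counit (p : Module.Dual k H) : conv k H p Coalgebra.counit = p := by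
  have := mul_one (WithConv.toConv p)
  exact congrArg WithConv.ofConv this

theorem counit_conv (p : Module.Dual k H) : conv k H Coalgebra.counit p = p := by
  have := one_mul (WithConv.toConv p)
  exact congrArg WithConv.ofConv this

theorem convRight_conv (p q : Module.Dual k H) (y : Smash k H A) :
    convRight k H A (conv k H q p) y = convRight k H A p (convRight k H A q y) := by
  induction y using Smash.induction with
  | zero => simp
  | mk r b => simp [conv_assoc]
  | add x y hx hy => simp only [map_add, hx, hy]

theorem convRight_counit (y : Smash k H A) :
    convRight k H A Coalgebra.counit y = y := by
  induction y using Smash.induction with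
  | zero => simp
  | mk r b => simp [conv_counit]
  | add x y hx hy => simp only [map_add, hx, hy]

theorem twist_mul (z z' : A ⊗[k] H) (y : Smash k H A) :
    twist k H A (z * z') y = twist k H A z (twist k H A z' y) := by
  induction y using Smash.induction with
  | zero => simp
  | add x y hx hy => simp only [map_add, hx, hy]
  | mk r b =>
    induction z with
    | zero => simp
    | add x y hx hy => simp only [map_add, add_mul, hx, hy, LinearMap.add_apply]
    | tmul a g =>
      induction z' with
      | zero => simp
      | add x y hx hy => simp only [map_add, mul_add, hx, hy, LinearMap.add_apply]
      | tmul a' g' =>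
        simp only [Algebra.TensorProduct.tmul_mul_tmul, twist_tmul_mk, mul_assoc]
        congr 1
        ext h
        simp [mul_assoc]

theorem twist_one (y : Smash k H A) : twist k H A 1 y = y := by
  induction y using Smash.induction with
  | zero => simp
  | add x y hx hy => simp only [map_add, hx, hy]
  | mk r b =>
    rw [Algebra.TensorProduct.one_def, twist_tmul_mk, one_mul]
    congr 1
    ext h
    simp

theorem trans_conv (g : H) (p q : Module.Dual k H) (h : H) :
    trans k H g (conv k H p q) h =
      LinearMap.mul' k k (TensorProduct.map p q (Coalgebra.comul h * Coalgebra.comul g)) := by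
  rw [trans_apply, conv_apply, Bialgebra.comul_mul]

/-- `(h ⊗ h') ↦ s(- h) * q(- h')`. -/
noncomputable def transTwo (s q : Module.Dual k H) : H ⊗[k] H →ₗ[k] Module.Dual k H :=
  TensorProduct.lift ((conv k H).compl₁₂ ((trans k H).flip s) ((trans k H).flip q))

theorem transTwo_apply (s q : Module.Dual k H) (z : H ⊗[k] H) (h : H) :
    transTwo s q z h =
      LinearMap.mul' k k (TensorProduct.map s q (Coalgebra.comul h * z)) := by
  induction z with
  | zero => simp
  | add x y hx hy => simp only [map_add, mul_add, LinearMap.add_apply, hx, hy]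
  | tmul g g' =>
    simp only [transTwo, TensorProduct.lift.tmul, LinearMap.compl₁₂_apply, LinearMap.flip_apply,
      conv_apply]
    generalize (Coalgebra.comul h : H ⊗[k] H) = c
    induction c with
    | zero => simp
    | add x y hx hy => simp only [map_add, add_mul, hx, hy]
    | tmul x y => simp

theorem transTwo_comul (s q : Module.Dual k H) (g : H) :
    transTwo s q (Coalgebra.comul g) = trans k H g (conv k H s q) := by
  ext h
  rw [transTwo_apply, trans_conv]

/-- `u ⊗ g ↦ q(- g)` convolved on the right with `u y`. -/
noncomputable def twistTwo (q : Module.Dual k H) (y : Smash k H A) :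
    A ⊗[k] H →ₗ[k] H →ₗ[k] Smash k H A :=
  ((convRight k H A).flip.compl₁₂ ((twist k H A).flip y) ((trans k H).flip q))

theorem twistTwo_apply (q : Module.Dual k H) (y : Smash k H A) (z : A ⊗[k] H) (g : H) :
    twistTwo q y z g = convRight k H A (trans k H g q) (twist k H A z y) := rfl

theorem twist_counit (t : A ⊗[k] H) :
    twist k H A t (Smash.mk k Coalgebra.counit 1) =
      Smash.mk k Coalgebra.counit
        (TensorProduct.rid k A ((Coalgebra.counit (R := k) (A := H)).lTensor A t)) := by
  induction t with
  | zero => simp [Smash.mk]; rfl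
  | add x y hx hy =>
    simp only [map_add, LinearMap.add_apply, hx, hy]
    exact (TensorProduct.tmul_add _ _ _).symm
  | tmul a g =>
    have : trans k H g Coalgebra.counit =
        (Coalgebra.counit g : k) • (Coalgebra.counit : H →ₗ[k] k) := by
      ext h; simp [mul_comm]
    rw [twist_tmul_mk, this]
    simp only [LinearMap.lTensor_tmul, TensorProduct.rid_tmul, mul_one]
    exact TensorProduct.smul_tmul (R := k) (Coalgebra.counit (R := k) g)
      (Coalgebra.counit : Module.Dual k H) a

/-- The pairing `(c ⊗ h) (q # b) = ⟨q, h⟩ c b`. -/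
noncomputable def evalSmash (k : Type u) (H : Type v) (A : Type w) [CommRing k] [Ring H]
    [Bialgebra k H] [Ring A] [Algebra k A] : A ⊗[k] H →ₗ[k] Smash k H A →ₗ[k] A :=
  ((TensorProduct.map₂ (Module.Dual.eval k H) (LinearMap.mul k A) :
    H ⊗[k] A →ₗ[k] Module.Dual k H ⊗[k] A →ₗ[k] k ⊗[k] A).compr₂
      (TensorProduct.lid k A).toLinearMap) ∘ₗ (TensorProduct.comm k A H).toLinearMap

@[simp] theorem evalSmash_tmul_mk (c : A) (h : H) (q : Module.Dual k H) (b : A) :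
    evalSmash k H A (c ⊗ₜ h) (Smash.mk k q b) = q h • (c * b) := rfl

end Tensor

section Algebra

variable (k : Type u) (H : Type v) (A : Type w) [CommRing k] [Ring H] [Bialgebra k H] [Ring A]
  [Algebra k A] [ComoduleAlgebra k H A]

/-- The coaction `ρ : A → A ⊗ H`. -/
noncomputable abbrev rho : A →ₐ[k] A ⊗[k] H := ComoduleAlgebra.coaction

/-- The subalgebra `A^{co H}` of coinvariants, `{a | ρ a = a ⊗ 1}`. -/
noncomputable def coinvariants : Subalgebra k A :=
  AlgHom.equalizer (rho k H A) Algebra.TensorProduct.includeLeft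

variable {k H A} in
theorem mem_coinvariants {a : A} : a ∈ coinvariants k H A ↔ rho k H A a = a ⊗ₜ[k] (1 : H) :=
  Iff.rfl

/-- `A^{co H} = k`: the structure map `k → A^{co H}` is bijective. -/
def CoinvariantsEqBase : Prop :=
  Function.Bijective (algebraMap k (coinvariants k H A))

/-- The identification of `A^{co H}` with `k` when `A^{co H} = k`. -/
noncomputable def CoinvariantsEqBase.equiv {k : Type u} {H : Type v} {A : Type w} [CommRing k]
    [Ring H] [Bialgebra k H] [Ring A] [Algebra k A] [ComoduleAlgebra k H A]
    (h : CoinvariantsEqBase k H A) : k ≃ₐ[k] coinvariants k H A :=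
  AlgEquiv.ofBijective (Algebra.ofId k (coinvariants k H A)) h

theorem CoinvariantsEqBase.algebraMap_equiv_symm {k : Type u} {H : Type v} {A : Type w}
    [CommRing k] [Ring H] [Bialgebra k H] [Ring A] [Algebra k A] [ComoduleAlgebra k H A]
    (h : CoinvariantsEqBase k H A) (b : coinvariants k H A) :
    algebraMap k A (h.equiv.symm b) = b := by
  have := h.equiv.apply_symm_apply b
  exact congrArg Subtype.val this

/-- The canonical map `can' : A ⊗ A → A ⊗ H`, `a' ⊗ a ↦ a' a₀ ⊗ a₁`. -/
noncomputable def can : A ⊗[k] A →ₗ[k] A ⊗[k] H :=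
  TensorProduct.lift ((LinearMap.mul k (A ⊗[k] H)).compl₁₂
    (Algebra.TensorProduct.includeLeft : A →ₐ[k] A ⊗[k] H).toLinearMap (rho k H A).toLinearMap)

theorem can_tmul (a' a : A) : can k H A (a' ⊗ₜ[k] a) = (a' ⊗ₜ[k] (1 : H)) * rho k H A a := rfl

/-- The left action of `H*` on `A`: `h* ⇀ a = ⟨h*, a₁⟩ a₀`. -/
noncomputable def hit : Module.Dual k H →ₗ[k] A →ₗ[k] A :=
  LinearMap.mk₂ k
    (fun p a => TensorProduct.rid k A (LinearMap.lTensor A p (rho k H A a)))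
    (fun p q a => by simp [LinearMap.lTensor_add])
    (fun c p a => by simp [LinearMap.lTensor_smul])
    (fun p a b => by simp)
    (fun c p a => by simp)

/-- The multiplication of `H* # A`: `(h* # a) (k* # b) = (k*(- a₁) * h*) # a₀ b`, in other words
`(k*₁ * h*) # (k*₂ ⇀ a) b`. -/
noncomputable def smashMul : Smash k H A →ₗ[k] Smash k H A →ₗ[k] Smash k H A :=
  TensorProduct.lift (M := Module.Dual k H) (N := A)
    (((LinearMap.llcomp k (Smash k H A) (Smash k H A) (Smash k H A)).compl₁₂
      (convRight k H A) (twist k H A ∘ₗ (rho k H A).toLinearMap)))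

variable {k H A}

theorem smashMul_mk (p : Module.Dual k H) (a : A) (y : Smash k H A) :
    smashMul k H A (Smash.mk k p a) y = convRight k H A p (twist k H A (rho k H A a) y) := rfl

/-- Coassociativity of the coaction, tested against a linear map. -/
theorem coassoc_lift {M : Type*} [AddCommGroup M] [Module k M] (a : A)
    (f : A ⊗[k] H →ₗ[k] H →ₗ[k] M) (g : A →ₗ[k] H ⊗[k] H →ₗ[k] M)
    (hfg : ∀ a h h', f (a ⊗ₜ h) h' = g a (h ⊗ₜ h')) :
    TensorProduct.lift (f ∘ₗ (rho k H A).toLinearMap) (rho k H A a) =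
      TensorProduct.lift (g.compl₂ Coalgebra.comul) (rho k H A a) := by
  have e1 : TensorProduct.lift f =
      TensorProduct.lift g ∘ₗ (TensorProduct.assoc k A H H).toLinearMap := by
    ext a h h'
    simp [hfg]
  have e2 : TensorProduct.lift (f ∘ₗ (rho k H A).toLinearMap) =
      TensorProduct.lift f ∘ₗ (rho k H A).toLinearMap.rTensor H := by
    ext a h
    simp
  have e3 : TensorProduct.lift (g.compl₂ Coalgebra.comul) =
      TensorProduct.lift g ∘ₗ (Coalgebra.comul (R := k) (A := H)).lTensor A := by
    ext a h
    simp
  rw [e2, e3, e1]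
  simp only [LinearMap.comp_apply, LinearEquiv.coe_coe]
  rw [ComoduleAlgebra.coassoc]

theorem twist_convRight (a : A) (q : Module.Dual k H) (y : Smash k H A) :
    twist k H A (rho k H A a) (convRight k H A q y) =
      TensorProduct.lift (twistTwo q y ∘ₗ (rho k H A).toLinearMap) (rho k H A a) := by
  induction y using Smash.induction with
  | zero =>
    have : twistTwo q (0 : Smash k H A) = 0 := by ext; simp [twistTwo]
    have h0 : TensorProduct.lift (0 : A →ₗ[k] H →ₗ[k] Smash k H A) = 0 := by ext; simp
    simp [this, h0]
  | add x y hx hy =>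
    have : twistTwo q (x + y) = twistTwo q x + twistTwo q y := by
      ext; simp [twistTwo]
    have h2 (f g : A →ₗ[k] H →ₗ[k] Smash k H A) :
        TensorProduct.lift (f + g) = TensorProduct.lift f + TensorProduct.lift g := by ext; simp
    rw [this, LinearMap.add_comp, h2]
    simp only [map_add, LinearMap.add_apply, hx, hy]
  | mk s c =>
    let g : A →ₗ[k] H ⊗[k] H →ₗ[k] Smash k H A :=
      ((TensorProduct.mk k (Module.Dual k H) A).flip : A →ₗ[k] Module.Dual k H →ₗ[k] Smash k H A)
        |>.compl₁₂ (LinearMap.mulRight k c) (transTwo s q)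
    have hg : ∀ a z, g a z = Smash.mk k (transTwo s q z) (a * c) := fun _ _ => rfl
    rw [coassoc_lift a (twistTwo q (Smash.mk k s c)) g ?_]
    · generalize rho k H A a = z
      induction z with
      | zero => simp
      | add x y hx hy => simp only [map_add, LinearMap.add_apply, hx, hy]
      | tmul a h =>
        rw [convRight_mk, twist_tmul_mk, TensorProduct.lift.tmul, LinearMap.compl₂_apply, hg,
          transTwo_comul]
    · intro a h h'
      rw [twistTwo_apply, hg]
      simp [transTwo]

theorem smashMul_twist (p q : Module.Dual k H) (b : A) (z : Smash k H A) (t : A ⊗[k] H) :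
    smashMul k H A (convRight k H A p (twist k H A t (Smash.mk k q b))) z =
      convRight k H A p (TensorProduct.lift
        (twistTwo q (twist k H A (rho k H A b) z) ∘ₗ (rho k H A).toLinearMap) t) := by
  induction t with
  | zero => simp
  | add x y hx hy => simp only [map_add, LinearMap.add_apply, hx, hy]
  | tmul a g =>
    simp [smashMul_mk, convRight_conv, twist_mul, twistTwo_apply]

theorem smashMul_assoc (x y z : Smash k H A) :
    smashMul k H A (smashMul k H A x y) z = smashMul k H A x (smashMul k H A y z) := by
  induction x using Smash.induction with
  | zero => simp
  | add x y hx hy => simp only [map_add, LinearMap.add_apply, hx, hy]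
  | mk p a =>
    induction y using Smash.induction with
    | zero => simp
    | add x y hx hy => simp only [map_add, LinearMap.add_apply, hx, hy]
    | mk q b =>
      rw [smashMul_mk, smashMul_mk, smashMul_mk, smashMul_twist, twist_convRight]

theorem smash_one_mul (x : Smash k H A) :
    smashMul k H A (Smash.mk k Coalgebra.counit 1) x = x := by
  rw [smashMul_mk, map_one, twist_one, convRight_counit]

theorem smash_mul_one (x : Smash k H A) :
    smashMul k H A x (Smash.mk k Coalgebra.counit 1) = x := by
  induction x using Smash.induction with
  | zero => simp
  | add x y hx hy => simp only [map_add, LinearMap.add_apply, hx, hy]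
  | mk p a =>
    rw [smashMul_mk, twist_counit, ComoduleAlgebra.counit_coaction, convRight_mk, counit_conv]

noncomputable instance : Ring (Smash k H A) where
  __ := (inferInstance : AddCommGroup (Smash k H A))
  mul x y := smashMul k H A x y
  one := Smash.mk k Coalgebra.counit 1
  mul_assoc := smashMul_assoc
  one_mul := smash_one_mul
  mul_one := smash_mul_one
  left_distrib x y z := map_add (smashMul k H A x) y z
  right_distrib x y z := by
    change smashMul k H A (x + y) z = smashMul k H A x z + smashMul k H A y z
    simp
  zero_mul x := by
    change smashMul k H A 0 x = 0
    simp
  mul_zero x := map_zero (smashMul k H A x)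

noncomputable instance : Algebra k (Smash k H A) :=
  Algebra.ofModule
    (fun c x y => by
      change smashMul k H A (c • x) y = c • smashMul k H A x y
      simp)
    (fun c x y => map_smul (smashMul k H A x) c y)

theorem smash_mul_def (x y : Smash k H A) : x * y = smashMul k H A x y := rfl

theorem smash_one_def : (1 : Smash k H A) = Smash.mk k Coalgebra.counit 1 := rfl

/-- The product of `H* # A` in terms of a coproduct `∑ p₁ ⊗ p₂` of `p ∈ H*`, characterised by
`⟨p, h g⟩ = ∑ ⟨p₁, h⟩ ⟨p₂, g⟩`: `(q # a) (p # b) = ∑ (p₁ * q) # (p₂ ⇀ a) b`. -/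
theorem smash_mul_eq_sum {ι : Type*} (s : Finset ι) (p q : Module.Dual k H)
    (p₁ p₂ : ι → Module.Dual k H)
    (hp : ∀ h g, p (h * g) = ∑ i ∈ s, p₁ i h * p₂ i g) (a b : A) :
    Smash.mk k q a * Smash.mk k p b =
      ∑ i ∈ s, Smash.mk k (conv k H (p₁ i) q) (hit k H A (p₂ i) a * b) := by
  have key (t : A ⊗[k] H) :
      convRight k H A q (twist k H A t (Smash.mk k p b)) =
        ∑ i ∈ s, Smash.mk k (conv k H (p₁ i) q)
          (TensorProduct.rid k A (LinearMap.lTensor A (p₂ i) t) * b) := by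
    induction t with
    | zero =>
      simp only [map_zero, LinearMap.zero_apply, zero_mul]
      exact (Finset.sum_eq_zero fun i _ => TensorProduct.tmul_zero _ _).symm
    | add x y hx hy =>
      simp only [map_add, LinearMap.add_apply, hx, hy, add_mul, ← Finset.sum_add_distrib]
      exact Finset.sum_congr rfl fun i _ => (TensorProduct.tmul_add _ _ _).symm
    | tmul a g =>
      have : trans k H g p = ∑ i ∈ s, p₂ i g • p₁ i := by
        ext h; simp [hp, mul_comm]
      rw [twist_tmul_mk, convRight_mk, this, map_sum, LinearMap.sum_apply]
      refine (TensorProduct.sum_tmul _ _ _).trans (Finset.sum_congr rfl fun i _ => ?_)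
      simp only [map_smul, LinearMap.smul_apply, LinearMap.lTensor_tmul, TensorProduct.rid_tmul,
        smul_mul_assoc]
      exact TensorProduct.smul_tmul _ _ _
  rw [smash_mul_def, smashMul_mk, key]
  rfl

theorem evalSmash_rho_mk (c : A) (q : Module.Dual k H) (b : A) :
    evalSmash k H A (rho k H A c) (Smash.mk k q b) = hit k H A q c * b := by
  change _ = TensorProduct.rid k A (LinearMap.lTensor A q (rho k H A c)) * b
  generalize rho k H A c = t
  induction t with
  | zero => simp
  | add x y hx hy => simp only [map_add, LinearMap.add_apply, hx, hy, add_mul]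
  | tmul c h => simp

theorem evalSmash_mul (u t : A ⊗[k] H) (y : Smash k H A) :
    evalSmash k H A (u * t) y = evalSmash k H A u (twist k H A t y) := by
  induction y using Smash.induction with
  | zero => simp
  | add x y hx hy => simp only [map_add, hx, hy]
  | mk r b =>
    induction u with
    | zero => simp
    | add x y hx hy => simp only [map_add, add_mul, hx, hy, LinearMap.add_apply]
    | tmul a g =>
      induction t with
      | zero => simp
      | add x y hx hy => simp only [map_add, mul_add, hx, hy, LinearMap.add_apply]
      | tmul a' g' =>
        simp [Algebra.TensorProduct.tmul_mul_tmul, mul_assoc]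

theorem evalSmash_rho_hit (p : Module.Dual k H) (c : A) (y : Smash k H A) :
    evalSmash k H A (rho k H A (hit k H A p c)) y =
      evalSmash k H A (rho k H A c) (convRight k H A p y) := by
  induction y using Smash.induction with
  | zero => simp
  | add x y hx hy => simp only [map_add, hx, hy]
  | mk q b =>
    let f : A ⊗[k] H →ₗ[k] H →ₗ[k] A :=
      LinearMap.mk₂ k (fun u h => p h • evalSmash k H A u (Smash.mk k q b))
        (by intros; simp) (by intro c u h; simp only [map_smul, LinearMap.smul_apply]; rw [smul_comm])
        (by intros; simp [add_smul]) (by intros; simp [mul_smul])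
    let g : A →ₗ[k] H ⊗[k] H →ₗ[k] A :=
      LinearMap.mk₂ k (fun a z => LinearMap.mul' k k (TensorProduct.map q p z) • (a * b))
        (by intros; simp [add_mul])
        (by intro c u h; rw [smul_mul_assoc, smul_comm])
        (by intros; simp [add_smul]) (by intros; simp [mul_smul])
    have := coassoc_lift c f g (by intro a h h'; simp [f, g, mul_comm, mul_smul])
    have e1 (t : A ⊗[k] H) : TensorProduct.lift (f ∘ₗ (rho k H A).toLinearMap) t =
        evalSmash k H A (rho k H A (TensorProduct.rid k A (LinearMap.lTensor A p t)))
          (Smash.mk k q b) := by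
      induction t with
      | zero => simp
      | add x y hx hy => simp only [map_add, LinearMap.add_apply, hx, hy]
      | tmul c h => simp [f]
    have e2 (t : A ⊗[k] H) : TensorProduct.lift (g.compl₂ Coalgebra.comul) t =
        evalSmash k H A t (convRight k H A p (Smash.mk k q b)) := by
      induction t with
      | zero => simp
      | add x y hx hy => simp only [map_add, LinearMap.add_apply, hx, hy]
      | tmul c h => simp [g, conv_apply]
    rw [e1, e2] at this
    exact this

/-- The `k`-linear map underlying `*can'`: `(h* # a) ↦ (b ↦ (h* ⇀ b) a)`. -/
noncomputable def starCanLin (k : Type u) (H : Type v) (A : Type w) [CommRing k] [Ring H]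
    [Bialgebra k H] [Ring A] [Algebra k A] [ComoduleAlgebra k H A] :
    Smash k H A →ₗ[k] Module.End k A :=
  (evalSmash k H A ∘ₗ (rho k H A).toLinearMap).flip

theorem starCanLin_apply (y : Smash k H A) (c : A) :
    starCanLin k H A y c = evalSmash k H A (rho k H A c) y := rfl

theorem starCanLin_mk (p : Module.Dual k H) (a b : A) :
    starCanLin k H A (Smash.mk k p a) b = hit k H A p b * a := by
  rw [starCanLin_apply, evalSmash_rho_mk]

theorem starCanLin_mul (x y : Smash k H A) :
    starCanLin k H A (x * y) = starCanLin k H A y * starCanLin k H A x := by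
  induction x using Smash.induction with
  | zero => simp
  | add x z hx hz => simp only [add_mul, mul_add, map_add, hx, hz]
  | mk p a =>
    ext c
    rw [Module.End.mul_apply, starCanLin_mk, starCanLin_apply, starCanLin_apply,
      map_mul (rho k H A), evalSmash_mul, evalSmash_rho_hit]
    rfl

theorem starCanLin_one : starCanLin k H A 1 = 1 := by
  ext c
  rw [smash_one_def, starCanLin_mk, mul_one]
  exact ComoduleAlgebra.counit_coaction c

/-- The map `*can' : H* # A → End(A)^op`, `*can'(h* # a)(b) = (h* ⇀ b) a`. -/
noncomputable def starCan (k : Type u) (H : Type v) (A : Type w) [CommRing k] [Ring H]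
    [Bialgebra k H] [Ring A] [Algebra k A] [ComoduleAlgebra k H A] :
    Smash k H A →ₐ[k] (Module.End k A)ᵐᵒᵖ :=
  AlgHom.ofLinearMap ((MulOpposite.opLinearEquiv k).toLinearMap ∘ₗ starCanLin k H A)
    (by simp [starCanLin_one])
    (fun x y => by simp [starCanLin_mul])

theorem starCan_mk (p : Module.Dual k H) (a b : A) :
    (starCan k H A (Smash.mk k p a)).unop b = hit k H A p b * a :=
  starCanLin_mk p a b

/-- `A` is a right `H* # A`-module through `*can'`: `a · y = *can'(y)(a)`. -/
noncomputable instance : Module (Smash k H A)ᵐᵒᵖ A :=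
  Module.compHom A (AlgHom.opComm (starCan k H A)).toRingHom

theorem op_smul_def (y : Smash k H A) (a : A) :
    MulOpposite.op y • a = starCanLin k H A y a := rfl

instance : IsScalarTower k (Smash k H A)ᵐᵒᵖ A where
  smul_assoc c y a := by
    induction y using MulOpposite.rec' with
    | _ y =>
    rw [← MulOpposite.op_smul, op_smul_def, op_smul_def, map_smul, LinearMap.smul_apply]

/-- `Q = {y ∈ H* # A | y (h* # 1) = ⟨h*, 1⟩ y for all h*}`, a left ideal of `H* # A`. -/
def Q (k : Type u) (H : Type v) (A : Type w) [CommRing k] [Ring H] [Bialgebra k H] [Ring A]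
    [Algebra k A] [ComoduleAlgebra k H A] : Submodule (Smash k H A) (Smash k H A) where
  carrier := {y | ∀ p : Module.Dual k H, y * Smash.mk k p 1 = p 1 • y}
  add_mem' {x y} hx hy p := by rw [add_mul, hx p, hy p, smul_add]
  zero_mem' p := by simp
  smul_mem' s y hy p := by rw [smul_eq_mul, mul_assoc, hy p, mul_smul_comm]

theorem mem_Q {y : Smash k H A} :
    y ∈ Q k H A ↔ ∀ p : Module.Dual k H, y * Smash.mk k p 1 = p 1 • y := Iff.rfl

end Algebra

section Morita

/-- The tensor product `P ⊗_S Q` of a right and a left module over a `k`-algebra `S`. -/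
abbrev BalancedTensor (k : Type*) (S : Type*) (P : Type*) (Q : Type*) [CommRing k] [Ring S]
    [AddCommGroup P] [Module k P] [Module Sᵐᵒᵖ P] [AddCommGroup Q] [Module k Q] [Module S Q] :
    Type _ :=
  (P ⊗[k] Q) ⧸ Submodule.span k
    {z : P ⊗[k] Q | ∃ (p : P) (s : S) (q : Q),
      z = (MulOpposite.op s • p) ⊗ₜ[k] q - p ⊗ₜ[k] (s • q)}

/-- The class `p ⊗_S q`. -/
def BalancedTensor.tmul (k : Type*) (S : Type*) {P : Type*} {Q : Type*} [CommRing k] [Ring S]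
    [AddCommGroup P] [Module k P] [Module Sᵐᵒᵖ P] [AddCommGroup Q] [Module k Q] [Module S Q]
    (p : P) (q : Q) : BalancedTensor k S P Q :=
  Submodule.Quotient.mk (p ⊗ₜ[k] q)

/-- A Morita context `(k, S, P, Q, τ, μ)` between a commutative ring `k` and a `k`-algebra `S`,
with bimodules `_k P_S` and `_S Q_k`. -/
structure MoritaContext (k : Type*) (S : Type*) (P : Type*) (Q : Type*) [CommRing k] [Ring S]
    [Algebra k S] [AddCommGroup P] [Module k P] [Module Sᵐᵒᵖ P] [IsScalarTower k Sᵐᵒᵖ P]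
    [AddCommGroup Q] [Module k Q] [Module S Q] [IsScalarTower k S Q] where
  τ : BalancedTensor k S P Q →ₗ[k] k
  μ : Q ⊗[k] P →ₗ[k] S
  μ_smul_left : ∀ (s : S) (q : Q) (p : P), μ ((s • q) ⊗ₜ[k] p) = s * μ (q ⊗ₜ[k] p)
  μ_smul_right : ∀ (s : S) (q : Q) (p : P),
    μ (q ⊗ₜ[k] (MulOpposite.op s • p)) = μ (q ⊗ₜ[k] p) * s
  τ_smul : ∀ (p : P) (q : Q) (p' : P),
    τ (BalancedTensor.tmul k S p q) • p' = MulOpposite.op (μ (q ⊗ₜ[k] p')) • p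
  μ_smul : ∀ (q : Q) (p : P) (q' : Q),
    μ (q ⊗ₜ[k] p) • q' = τ (BalancedTensor.tmul k S p q') • q

/-- A Morita context is strict when both of its maps are isomorphisms. -/
def MoritaContext.IsStrict {k : Type*} {S : Type*} {P : Type*} {Q : Type*} [CommRing k] [Ring S]
    [Algebra k S] [AddCommGroup P] [Module k P] [Module Sᵐᵒᵖ P] [IsScalarTower k Sᵐᵒᵖ P]
    [AddCommGroup Q] [Module k Q] [Module S Q] [IsScalarTower k S Q] (M : MoritaContext k S P Q) : Prop :=
  Function.Bijective M.τ ∧ Function.Bijective M.μ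

variable {k : Type u} {H : Type v} {A : Type w} [CommRing k] [Ring H] [Bialgebra k H] [Ring A]
  [Algebra k A]

theorem tensor_ext_of_projective (hH : Module.Projective k H) (hf : Module.Finite k H)
    {z z' : A ⊗[k] H}
    (h : ∀ p : Module.Dual k H, LinearMap.lTensor A p z = LinearMap.lTensor A p z') : z = z' := by
  obtain ⟨n, f, g, -, -, hfg⟩ := Module.Finite.exists_comp_eq_id_of_projective k H
  have key : ∑ i, (LinearMap.toSpanSingleton k H (f (Pi.single i 1))) ∘ₗ
      (LinearMap.proj i ∘ₗ g : Module.Dual k H) = LinearMap.id := by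
    ext x
    conv_rhs => rw [← hfg]
    simp only [LinearMap.sum_apply, LinearMap.comp_apply, LinearMap.toSpanSingleton_apply,
      LinearMap.proj_apply, ← map_smul, ← map_sum]
    congr 1
    ext i
    simp [Finset.sum_apply, Pi.single_apply]
  have hz (t : A ⊗[k] H) : t = ∑ i, LinearMap.lTensor A
      (LinearMap.toSpanSingleton k H (f (Pi.single i 1)))
      (LinearMap.lTensor A (LinearMap.proj i ∘ₗ g : Module.Dual k H) t) := by
    conv_lhs => rw [← LinearMap.lTensor_id_apply (R := k) A H t, ← key]
    have : LinearMap.lTensor A (∑ i, (LinearMap.toSpanSingleton k H (f (Pi.single i 1))) ∘ₗ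
      (LinearMap.proj i ∘ₗ g : Module.Dual k H)) = ∑ i, LinearMap.lTensor A
        ((LinearMap.toSpanSingleton k H (f (Pi.single i 1))) ∘ₗ
      (LinearMap.proj i ∘ₗ g : Module.Dual k H)) := map_sum (LinearMap.lTensorHom A) _ _
    rw [this, LinearMap.sum_apply]
    simp only [LinearMap.lTensor_comp, LinearMap.comp_apply]
  rw [hz z, hz z']
  simp only [h]

variable [ComoduleAlgebra k H A]

theorem starCanLin_mem (hH : IsProgenerator k H) (a : A) {y : Smash k H A} (hy : y ∈ Q k H A) :
    starCanLin k H A y a ∈ coinvariants k H A := by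
  rw [mem_coinvariants]
  refine tensor_ext_of_projective hH.projective hH.finite fun p => ?_
  apply (TensorProduct.rid k A).injective
  have h1 : starCanLin k H A (Smash.mk k p 1) (starCanLin k H A y a) =
      p 1 • starCanLin k H A y a := by
    rw [← Module.End.mul_apply, ← starCanLin_mul, hy p, map_smul, LinearMap.smul_apply]
  rw [starCanLin_mk, mul_one] at h1
  change hit k H A p (starCanLin k H A y a) = _
  rw [h1]
  simp

theorem mk_counit_mul_mk (p : Module.Dual k H) (b : A) :
    Smash.mk k p 1 * Smash.mk k Coalgebra.counit b = Smash.mk k p b := by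
  rw [smash_mul_def, smashMul_mk, map_one, twist_one, convRight_mk, counit_conv]

/-- For `q ∈ Q`, `q (h* # c) = ⟨h*, 1⟩ q (ε # c)`, whence `q (ε # a) y = q (ε # *can'(y)(a))`. -/
theorem Q_mul_mul {q : Smash k H A} (hq : q ∈ Q k H A) (a : A) (y : Smash k H A) :
    q * Smash.mk k Coalgebra.counit a * y =
      q * Smash.mk k Coalgebra.counit (starCanLin k H A y a) := by
  have add' (b c : A) : Smash.mk k (Coalgebra.counit : Module.Dual k H) (b + c) =
      Smash.mk k Coalgebra.counit b + Smash.mk k Coalgebra.counit c :=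
    TensorProduct.tmul_add _ _ _
  have zero' : Smash.mk k (Coalgebra.counit : Module.Dual k H) (0 : A) = 0 :=
    TensorProduct.tmul_zero _ _
  have smul' (r : k) (c : A) : Smash.mk k (Coalgebra.counit : Module.Dual k H) (r • c) =
      r • Smash.mk k Coalgebra.counit c :=
    TensorProduct.tmul_smul _ _ _
  have hq' (p : Module.Dual k H) (c : A) :
      q * Smash.mk k p c = p 1 • (q * Smash.mk k Coalgebra.counit c) := by
    rw [← mk_counit_mul_mk p c, ← mul_assoc, hq p, smul_mul_assoc]
  rw [mul_assoc, smash_mul_def (Smash.mk k _ a), smashMul_mk, convRight_counit, starCanLin_apply]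
  generalize rho k H A a = t
  induction t with
  | zero => simp [zero']
  | add x y hx hy => simp only [map_add, LinearMap.add_apply, mul_add, hx, hy, add']
  | tmul c h =>
    induction y using Smash.induction with
    | zero => simp [zero']
    | add x y hx hy => simp only [map_add, mul_add, hx, hy, add']
    | mk p b =>
      rw [twist_tmul_mk, hq', evalSmash_tmul_mk, smul', mul_smul_comm, trans_apply, one_mul]

/-- `A ⊗ Q → A^{co H}`, `a ⊗ y ↦ *can'(y)(a)`. -/
noncomputable def tauCo (hH : IsProgenerator k H) :
    A ⊗[k] Q k H A →ₗ[k] coinvariants k H A :=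
  TensorProduct.lift (LinearMap.mk₂ k
    (fun a y => (⟨starCanLin k H A y a, starCanLin_mem hH a y.2⟩ : coinvariants k H A))
    (fun _ _ _ => Subtype.ext (by simp))
    (fun _ _ _ => Subtype.ext (by simp))
    (fun _ _ _ => Subtype.ext (by simp))
    (fun _ _ _ => Subtype.ext (by simp)))

theorem coe_tauCo_tmul (hH : IsProgenerator k H) (a : A) (y : Q k H A) :
    (tauCo hH (a ⊗ₜ y) : A) = starCanLin k H A y a := rfl

/-- The map `τ : A ⊗_{H* # A} Q → A^{co H}`, `τ (a ⊗ y) = *can'(y)(a)`. -/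
noncomputable def tau (hH : IsProgenerator k H) :
    BalancedTensor k (Smash k H A) A (Q k H A) →ₗ[k] coinvariants k H A :=
  Submodule.liftQ _ (tauCo hH) (by
    rw [Submodule.span_le]
    rintro _ ⟨a, s, q, rfl⟩
    rw [SetLike.mem_coe, LinearMap.mem_ker, map_sub, sub_eq_zero]
    apply Subtype.ext
    rw [coe_tauCo_tmul, coe_tauCo_tmul, op_smul_def, Submodule.coe_smul, smul_eq_mul,
      starCanLin_mul, Module.End.mul_apply])

variable (k H A) in
/-- The map `μ : Q ⊗ A → H* # A`, `μ (y ⊗ a) = y (ε # a)`. -/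
noncomputable def mu : Q k H A ⊗[k] A →ₗ[k] Smash k H A :=
  TensorProduct.lift ((LinearMap.mul k (Smash k H A)).compl₁₂
    ((Q k H A).subtype.restrictScalars k)
    (TensorProduct.mk k (Module.Dual k H) A Coalgebra.counit : A →ₗ[k] Smash k H A))

theorem mu_tmul (y : Q k H A) (a : A) :
    mu k H A (y ⊗ₜ a) = (y : Smash k H A) * Smash.mk k Coalgebra.counit a := rfl

/-- The Morita context `(k, H* # A, A, Q, τ, μ)`, when `A^{co H} = k`. -/
noncomputable def moritaContext (hH : IsProgenerator k H) (h : CoinvariantsEqBase k H A) :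
    MoritaContext k (Smash k H A) A (Q k H A) where
  τ := h.equiv.symm.toLinearMap ∘ₗ tau hH
  μ := mu k H A
  μ_smul_left s q p := by
    rw [mu_tmul, mu_tmul, Submodule.coe_smul, smul_eq_mul, mul_assoc]
  μ_smul_right s q p := by
    rw [mu_tmul, mu_tmul, op_smul_def, Q_mul_mul q.2]
  τ_smul p q p' := by
    have : algebraMap k A (h.equiv.symm (tau hH (BalancedTensor.tmul k (Smash k H A) p q))) =
        starCanLin k H A q p := h.algebraMap_equiv_symm _
    rw [Algebra.smul_def]
    change algebraMap k A (h.equiv.symm (tau hH (BalancedTensor.tmul k (Smash k H A) p q))) * p' = _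
    rw [this, op_smul_def, mu_tmul, starCanLin_mul, Module.End.mul_apply, starCanLin_mk]
    congr 1
    exact (ComoduleAlgebra.counit_coaction (starCanLin k H A q p)).symm
  μ_smul q p q' := by
    have : algebraMap k A (h.equiv.symm (tau hH (BalancedTensor.tmul k (Smash k H A) p q'))) =
        starCanLin k H A q' p := h.algebraMap_equiv_symm _
    apply Subtype.ext
    rw [mu_tmul, Submodule.coe_smul, smul_eq_mul, Q_mul_mul q.2, ← this]
    change _ = h.equiv.symm (tau hH (BalancedTensor.tmul k (Smash k H A) p q')) • (q : Smash k H A)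
    generalize h.equiv.symm (tau hH (BalancedTensor.tmul k (Smash k H A) p q')) = c
    rw [Algebra.algebraMap_eq_smul_one]
    have smul' : Smash.mk k (Coalgebra.counit : Module.Dual k H) (c • (1 : A)) =
      c • 1 := TensorProduct.tmul_smul _ _ _
    rw [smul', mul_smul_comm, mul_one]

end Morita

section HopfModules

open CategoryTheory

/-- A relative Hopf module: a `k`-module `M` with a right `A`-action and a right `H`-coaction
`ρ m = m₀ ⊗ m₁` such that `ρ (m a) = m₀ a₀ ⊗ m₁ a₁`. -/
structure RelHopfModule (k H A : Type u) [CommRing k] [Ring H] [Bialgebra k H] [Ring A]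
    [Algebra k A] [ComoduleAlgebra k H A] where
  carrier : Type u
  [addCommGroup : AddCommGroup carrier]
  [module : Module k carrier]
  [rightModule : Module Aᵐᵒᵖ carrier]
  [isScalarTower : IsScalarTower k Aᵐᵒᵖ carrier]
  coaction : carrier →ₗ[k] carrier ⊗[k] H
  coassoc : ∀ m : carrier,
    TensorProduct.assoc k carrier H H (coaction.rTensor H (coaction m)) =
      (Coalgebra.comul (R := k) (A := H)).lTensor carrier (coaction m)
  counit_coaction : ∀ m : carrier,
    TensorProduct.rid k carrier
      ((Coalgebra.counit (R := k) (A := H)).lTensor carrier (coaction m)) = m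
  coaction_smul : ∀ (m : carrier) (a : A),
    coaction (MulOpposite.op a • m) =
      TensorProduct.map₂
        ((Algebra.lsmul k k carrier).toLinearMap ∘ₗ
          (MulOpposite.opLinearEquiv k : A ≃ₗ[k] Aᵐᵒᵖ).toLinearMap).flip
        (LinearMap.mul k H) (coaction m) (rho k H A a)

namespace RelHopfModule

variable {k H A : Type u} [CommRing k] [Ring H] [Bialgebra k H] [Ring A]
  [Algebra k A] [ComoduleAlgebra k H A]

attribute [instance] addCommGroup module rightModule isScalarTower

/-- Morphisms of relative Hopf modules: right `A`-linear and right `H`-colinear maps. -/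
@[ext]
structure Hom (M N : RelHopfModule k H A) where
  toLinearMap : M.carrier →ₗ[k] N.carrier
  map_op_smul : ∀ (a : A) (m : M.carrier),
    toLinearMap (MulOpposite.op a • m) = MulOpposite.op a • toLinearMap m
  colinear : ∀ m : M.carrier,
    N.coaction (toLinearMap m) = toLinearMap.rTensor H (M.coaction m)

/-- The category `M_A^H` of relative Hopf modules. -/
instance : Category (RelHopfModule k H A) where
  Hom := Hom
  id M := ⟨LinearMap.id, fun _ _ => rfl, fun m => by simp⟩
  comp f g := ⟨g.toLinearMap ∘ₗ f.toLinearMap,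
    fun a m => by simp [f.map_op_smul, g.map_op_smul],
    fun m => by simp [g.colinear, f.colinear, LinearMap.rTensor_comp]⟩

@[ext]
theorem hom_ext {M N : RelHopfModule k H A} {f g : M ⟶ N}
    (h : Hom.toLinearMap f = Hom.toLinearMap g) : f = g := Hom.ext h

@[simp] theorem id_toLinearMap (M : RelHopfModule k H A) :
    Hom.toLinearMap (𝟙 M) = LinearMap.id := rfl

@[simp] theorem comp_toLinearMap {M N P : RelHopfModule k H A} (f : M ⟶ N) (g : N ⟶ P) :
    Hom.toLinearMap (f ≫ g) = Hom.toLinearMap g ∘ₗ Hom.toLinearMap f := rfl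

/-- The coinvariants `M^{co H} = {m | ρ m = m ⊗ 1}`. -/
def coinv (M : RelHopfModule k H A) : Submodule k M.carrier :=
  LinearMap.eqLocus M.coaction ((TensorProduct.mk k M.carrier H).flip 1)

theorem mem_coinv {M : RelHopfModule k H A} {m : M.carrier} :
    m ∈ M.coinv ↔ M.coaction m = m ⊗ₜ[k] (1 : H) := Iff.rfl

/-- The right `A`-action on `N ⊗ A`, `(n ⊗ b) a = n ⊗ b a`. -/
noncomputable def inducedAction (k A : Type u) (N : Type u) [CommRing k] [Ring A] [Algebra k A]
    [AddCommGroup N] [Module k N] : Aᵐᵒᵖ →+* Module.End k (N ⊗[k] A) where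
  toFun a := (LinearMap.mulRight k a.unop).lTensor N
  map_one' := by ext; simp
  map_mul' a b := by ext; simp [mul_assoc]
  map_zero' := by ext; simp
  map_add' a b := by ext; simp [mul_add, TensorProduct.tmul_add]

/-- The relative Hopf module `N ⊗ A`, with `(n ⊗ b) a = n ⊗ b a` and
`ρ (n ⊗ b) = n ⊗ b₀ ⊗ b₁`. -/
noncomputable def induced (k H A : Type u) [CommRing k] [Ring H] [Bialgebra k H] [Ring A]
    [Algebra k A] [ComoduleAlgebra k H A] (N : Type u) [AddCommGroup N] [Module k N] :
    RelHopfModule k H A :=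
  letI : Module Aᵐᵒᵖ (N ⊗[k] A) := Module.compHom _ (inducedAction k A N)
  haveI : IsScalarTower k Aᵐᵒᵖ (N ⊗[k] A) := ⟨fun c a x => by
    change (LinearMap.mulRight k (c • a).unop).lTensor N x =
      c • (LinearMap.mulRight k a.unop).lTensor N x
    induction x with
    | zero => simp
    | add x y hx hy => simp only [map_add, smul_add, hx, hy]
    | tmul n b => simp⟩
  { carrier := N ⊗[k] A
    coaction := (TensorProduct.assoc k N A H).symm.toLinearMap ∘ₗ
      (rho k H A).toLinearMap.lTensor N
    coassoc := fun x => by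
      induction x with
      | zero => simp
      | add x y hx hy => simp only [map_add, hx, hy]
      | tmul n b =>
        have e1 (t : A ⊗[k] H) : TensorProduct.assoc k (N ⊗[k] A) H H
            (((TensorProduct.assoc k N A H).symm.toLinearMap ∘ₗ
              (rho k H A).toLinearMap.lTensor N).rTensor H
                ((TensorProduct.assoc k N A H).symm (n ⊗ₜ[k] t))) =
            (TensorProduct.assoc k N A (H ⊗[k] H)).symm (n ⊗ₜ[k]
              TensorProduct.assoc k A H H ((rho k H A).toLinearMap.rTensor H t)) := by
          induction t with
          | zero => simp
          | add x y hx hy => simp only [TensorProduct.tmul_add, map_add, hx, hy]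
          | tmul a h =>
            simp only [TensorProduct.assoc_symm_tmul, LinearMap.rTensor_tmul,
              LinearMap.comp_apply, LinearMap.lTensor_tmul, AlgHom.toLinearMap_apply,
              LinearEquiv.coe_coe]
            generalize rho k H A a = s
            induction s with
            | zero => simp
            | add x y hx hy =>
              simp only [TensorProduct.tmul_add, TensorProduct.add_tmul, map_add, hx, hy]
            | tmul a' h' => simp
        have e2 (t : A ⊗[k] H) :
            (Coalgebra.comul (R := k) (A := H)).lTensor (N ⊗[k] A)
              ((TensorProduct.assoc k N A H).symm (n ⊗ₜ[k] t)) =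
            (TensorProduct.assoc k N A (H ⊗[k] H)).symm (n ⊗ₜ[k]
              (Coalgebra.comul (R := k) (A := H)).lTensor A t) := by
          induction t with
          | zero => simp
          | add x y hx hy => simp only [TensorProduct.tmul_add, map_add, hx, hy]
          | tmul a h =>
            simp only [TensorProduct.assoc_symm_tmul, LinearMap.lTensor_tmul]
        exact (e1 _).trans ((congrArg (fun z => (TensorProduct.assoc k N A (H ⊗[k] H)).symm
          (n ⊗ₜ[k] z)) (ComoduleAlgebra.coassoc b)).trans (e2 _).symm)
    counit_coaction := fun x => by
      induction x with
      | zero => simp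
      | add x y hx hy => simp only [map_add, hx, hy]
      | tmul n b =>
        have e (t : A ⊗[k] H) : TensorProduct.rid k (N ⊗[k] A)
            ((Coalgebra.counit (R := k) (A := H)).lTensor (N ⊗[k] A)
              ((TensorProduct.assoc k N A H).symm (n ⊗ₜ[k] t))) =
            n ⊗ₜ[k] TensorProduct.rid k A ((Coalgebra.counit (R := k) (A := H)).lTensor A t) := by
          induction t with
          | zero => simp
          | add x y hx hy => simp only [TensorProduct.tmul_add, map_add, hx, hy]
          | tmul a h => simp
        exact (e _).trans (congrArg (n ⊗ₜ[k] ·) (ComoduleAlgebra.counit_coaction b))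
    coaction_smul := fun x a => by
      change ((TensorProduct.assoc k N A H).symm.toLinearMap ∘ₗ
        (rho k H A).toLinearMap.lTensor N) ((LinearMap.mulRight k a).lTensor N x) = _
      induction x with
      | zero => simp
      | add x y hx hy => simp only [map_add, LinearMap.add_apply, hx, hy]
      | tmul n b =>
        simp only [LinearMap.comp_apply, LinearMap.lTensor_tmul, AlgHom.toLinearMap_apply,
          LinearMap.mulRight_apply, map_mul (rho k H A), LinearEquiv.coe_coe]
        generalize rho k H A b = s
        generalize rho k H A a = t
        induction s with
        | zero => simp
        | add x y hx hy =>
          simp only [TensorProduct.tmul_add, map_add, add_mul, LinearMap.add_apply, hx, hy]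
        | tmul b h =>
          induction t with
          | zero => simp
          | add x y hx hy => simp only [TensorProduct.tmul_add, map_add, mul_add, hx, hy]
          | tmul a g =>
            rw [Algebra.TensorProduct.tmul_mul_tmul, TensorProduct.assoc_symm_tmul,
              TensorProduct.assoc_symm_tmul]
            rfl }

theorem induced_op_smul {N : Type u} [AddCommGroup N] [Module k N] (a : A)
    (x : (induced k H A N).carrier) :
    MulOpposite.op a • x = (LinearMap.mulRight k a).lTensor N x := rfl

theorem induced_coaction_tmul {N : Type u} [AddCommGroup N] [Module k N] (n : N) (b : A) :
    (induced k H A N).coaction (n ⊗ₜ[k] b : N ⊗[k] A) =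
      (TensorProduct.assoc k N A H).symm (n ⊗ₜ[k] rho k H A b) := rfl

variable (k H A) in
/-- The functor `F = - ⊗ A : M_k → M_A^H`. -/
noncomputable def induction : ModuleCat.{u} k ⥤ RelHopfModule k H A where
  obj N := induced k H A N
  map {N N'} f :=
    { toLinearMap := f.hom.rTensor A
      map_op_smul := fun a x => by
        rw [induced_op_smul, induced_op_smul]
        exact LinearMap.congr_fun ((LinearMap.rTensor_comp_lTensor _ _ _).trans
          (LinearMap.lTensor_comp_rTensor _ _ _).symm) x
      colinear := fun x => by
        refine TensorProduct.induction_on (motive := fun x : N ⊗[k] A =>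
          (induced k H A N').coaction (f.hom.rTensor A x) =
            (f.hom.rTensor A).rTensor H ((induced k H A N).coaction x)) x ?_ ?_ ?_
        · exact (map_zero _).trans (map_zero _).symm
        · intro n b
          change (TensorProduct.assoc k N' A H).symm (f.hom n ⊗ₜ[k] rho k H A b) =
            (f.hom.rTensor A).rTensor H
              ((TensorProduct.assoc k N A H).symm (n ⊗ₜ[k] rho k H A b))
          generalize rho k H A b = t
          induction t with
          | zero => simp
          | add x y hx hy => simp only [TensorProduct.tmul_add, map_add, hx, hy]
          | tmul a h => simp
        · intro x y hx hy
          rw [map_add]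
          refine (map_add _ _ _).trans ?_
          rw [hx, hy]
          refine Eq.trans (map_add _ _ _).symm ?_
          congr 1
          exact (map_add _ _ _).symm }
  map_id N := by
    apply hom_ext
    exact LinearMap.rTensor_id _ _
  map_comp f g := by
    apply hom_ext
    exact LinearMap.rTensor_comp _ _ _

variable (k H A) in
/-- The functor `G = (-)^{co H} : M_A^H → M_k`. -/
def coinvariantsFunctor : RelHopfModule k H A ⥤ ModuleCat.{u} k where
  obj M := ModuleCat.of k M.coinv
  map {M N} f := ModuleCat.ofHom ((Hom.toLinearMap f).restrict (p := M.coinv) (q := N.coinv)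
    (fun m hm => by
      rw [mem_coinv] at hm ⊢
      rw [Hom.colinear, hm, LinearMap.rTensor_tmul]))
  map_id M := rfl
  map_comp f g := rfl

/-- The bilinear map `M^{co H} × A → M`, `(m, a) ↦ m a`. -/
noncomputable def actCoinv (M : RelHopfModule k H A) : M.coinv →ₗ[k] A →ₗ[k] M.carrier :=
  ((Algebra.lsmul k k M.carrier).toLinearMap ∘ₗ
    (MulOpposite.opLinearEquiv k : A ≃ₗ[k] Aᵐᵒᵖ).toLinearMap).flip ∘ₗ M.coinv.subtype

@[simp] theorem actCoinv_apply (M : RelHopfModule k H A) (m : M.coinv) (a : A) :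
    actCoinv M m a = MulOpposite.op a • (m : M.carrier) := rfl

/-- The morphism `M^{co H} ⊗ A → M`, `m ⊗ a ↦ m a`. -/
noncomputable def counitHom (M : RelHopfModule k H A) : Hom (induced k H A M.coinv) M :=
  { toLinearMap := TensorProduct.lift (actCoinv M)
    map_op_smul := fun a x => by
      rw [induced_op_smul]
      refine TensorProduct.induction_on (motive := fun x : M.coinv ⊗[k] A =>
        TensorProduct.lift (actCoinv M) ((LinearMap.mulRight k a).lTensor M.coinv x) =
          MulOpposite.op a • TensorProduct.lift (actCoinv M) x) x ?_ ?_ ?_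
      · simp
      · intro m b
        simp [mul_smul]
      · intro x y hx hy
        simp only [map_add, smul_add, hx, hy]
    colinear := fun x => by
      refine TensorProduct.induction_on (motive := fun x : M.coinv ⊗[k] A =>
        M.coaction (TensorProduct.lift (actCoinv M) x) =
          (TensorProduct.lift (actCoinv M)).rTensor H
            (((TensorProduct.assoc k M.coinv A H).symm.toLinearMap ∘ₗ
              (rho k H A).toLinearMap.lTensor M.coinv) x)) x ?_ ?_ ?_
      · simp
      · intro m b
        rw [TensorProduct.lift.tmul, actCoinv_apply, M.coaction_smul, mem_coinv.1 m.2]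
        simp only [LinearMap.comp_apply, LinearMap.lTensor_tmul,
          AlgHom.toLinearMap_apply, LinearEquiv.coe_coe]
        generalize rho k H A b = t
        induction t with
        | zero => simp
        | add x y hx hy => simp only [TensorProduct.tmul_add, map_add, hx, hy]
        | tmul a h => simp
      · intro x y hx hy
        simp only [map_add, hx, hy] }

variable (k H A) in
/-- The adjunction between `- ⊗ A` and `(-)^{co H}`, with unit `n ↦ n ⊗ 1` and counit
`m ⊗ a ↦ m a`. -/
noncomputable def adjunction : induction k H A ⊣ coinvariantsFunctor k H A where
  unit :=
    { app N := ModuleCat.ofHom (((TensorProduct.mk k N A).flip 1).codRestrict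
        (coinv (induced k H A N)) (fun n => by
          change (TensorProduct.assoc k N A H).symm (n ⊗ₜ[k] rho k H A 1) =
            (n ⊗ₜ[k] (1 : A)) ⊗ₜ[k] (1 : H)
          rw [map_one, Algebra.TensorProduct.one_def, TensorProduct.assoc_symm_tmul]))
      naturality := fun N N' f => by
        ext n
        apply Subtype.ext
        rfl }
  counit :=
    { app M := counitHom M
      naturality := fun M N f => by
        apply hom_ext
        refine TensorProduct.ext' fun m a => ?_
        exact (Hom.map_op_smul f a (Subtype.val (p := (· ∈ M.coinv)) m)).symm }
  left_triangle_components N := by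
    apply hom_ext
    refine TensorProduct.ext' fun n a => ?_
    change (LinearMap.mulRight k a).lTensor N (n ⊗ₜ[k] (1 : A)) = n ⊗ₜ[k] a
    simp
  right_triangle_components M := by
    ext m
    apply Subtype.ext
    exact one_smul Aᵐᵒᵖ (Subtype.val (p := (· ∈ M.coinv)) m)

end RelHopfModule

end HopfModules

end HopfGalois

namespace HopfGalois

/-! ### Progenerators over a commutative ring and faithfully flat descent -/

section ModuleTheory

variable {k : Type*} [CommRing k]

/-! The equivalences follow from one duality and two ways of writing an identity as a finite sum.

Since `H` is finitely generated projective, `H* ⊗ A` is the left `A`-dual of `A ⊗ H`, while `End(A)`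
is the left `A`-dual of `A ⊗ A`. Under these identifications `*can'` is the dual of `can'`
(`evalSmash_can_tmul`), so bijectivity of `can'` passes to `*can'`. Moreover `A ⊗ A ≅ A ⊗ H` is then
finitely generated projective over `A`, and faithfully flat descent makes `A` a progenerator.
Conversely, if `*can'` is bijective and `A` has a dual basis `bᵢ, βᵢ`, the elements `qᵢ` of `H* # A`
acting as `c ↦ βᵢ(c) 1` satisfy `∑ qᵢ (ε # (bᵢ · y)) = y` (`sum_mul_mk_counit_eq`), and they give an
explicit inverse of `can'`.

The same `qᵢ` lie in `Q`, so this formula also says that `μ` is onto. The trace ideal of `A` being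
`k` makes `τ` onto and forces `A^{co H} = k`. In a Morita context surjective maps are injective. In
the other direction, once `A^{co H} = k`, an expression `1 = ∑ qₓ (ε # aₓ)` with `qₓ ∈ Q` is a dual
basis of `A` in disguise and makes `*can'` bijective (`bijective_starCanLin_of_mu_surjective`).

For the categorical statement, every relative Hopf module is a right `H* # A`-module and `Q` carries
it into its coinvariants. Hence `m ↦ ∑ m · qₓ ⊗ aₓ` inverts the counit, and surjectivity of `τ`
shows that the coinvariants of `N ⊗ A` are `N ⊗ 1`. Conversely `H* # A` is itself a relative Hopf
module with coinvariants inside `Q`, so the counit there factors through `μ` and its surjectivity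
gives that of `μ`. -/

theorem exists_dual_basis (M : Type*) [AddCommGroup M] [Module k M] [Module.Finite k M]
    [Module.Projective k M] :
    ∃ (n : ℕ) (e : Fin n → M) (f : Fin n → Module.Dual k M), ∀ x, ∑ i, f i x • e i = x := by
  obtain ⟨n, f, g, -, -, hfg⟩ := Module.Finite.exists_comp_eq_id_of_projective k M
  refine ⟨n, fun i => f (Pi.single i 1), fun i => LinearMap.proj i ∘ₗ g, fun x => ?_⟩
  conv_rhs => rw [← LinearMap.id_apply (R := k) x, ← hfg]
  simp only [LinearMap.comp_apply, LinearMap.proj_apply, ← map_smul, ← map_sum]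
  congr 1
  ext i
  simp [Finset.sum_apply, Pi.single_apply]

theorem finite_projective_of_dual_basis {M : Type*} [AddCommGroup M] [Module k M] {ι : Type*}
    [Fintype ι] (e : ι → M) (f : ι → Module.Dual k M) (h : ∀ x, ∑ i, f i x • e i = x) :
    Module.Finite k M ∧ Module.Projective k M := by
  have hs : Fintype.linearCombination k e ∘ₗ LinearMap.pi f = LinearMap.id := by
    ext x
    simp [Fintype.linearCombination_apply, h]
  exact ⟨Module.Finite.of_surjective (Fintype.linearCombination k e) fun x =>
      ⟨LinearMap.pi f x, LinearMap.congr_fun hs x⟩,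
    Module.Projective.of_split (LinearMap.pi f) (Fintype.linearCombination k e) hs⟩

/-- Nakayama: some `r ≡ 1` modulo `I` kills `M`. Faithfulness gives `r = 0`, so `1 ∈ I`. -/
theorem IsProgenerator.eq_top_of_smul_eq_top {M : Type*} [AddCommGroup M] [Module k M]
    (hM : IsProgenerator k M) {I : Ideal k} (h : I • (⊤ : Submodule k M) = ⊤) : I = ⊤ := by
  have := hM.finite
  have := hM.faithful
  obtain ⟨r, hr, hr'⟩ := Submodule.exists_sub_one_mem_and_smul_eq_zero_of_fg_of_le_smul I
    (⊤ : Submodule k M) Module.Finite.fg_top h.ge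
  have hr0 : r = 0 := FaithfulSMul.eq_of_smul_eq_smul (α := M) fun m => by
    rw [hr' m trivial, zero_smul]
  rw [Ideal.eq_top_iff_one, ← neg_neg (1 : k)]
  exact I.neg_mem (by simpa [hr0] using hr)

theorem IsProgenerator.faithfullyFlat {M : Type*} [AddCommGroup M] [Module k M]
    (hM : IsProgenerator k M) : Module.FaithfullyFlat k M := by
  have := hM.projective
  exact (Module.FaithfullyFlat.iff_flat_and_ideal_smul_eq_top k M).2
    ⟨inferInstance, fun I hI => hM.eq_top_of_smul_eq_top hI⟩

/-- The trace ideal `T` satisfies `T M = M` because `x = ∑ fᵢ(x) eᵢ`, and for a progenerator this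
forces `T = k`. -/
theorem IsProgenerator.exists_sum_dual_eq_one {M : Type*} [AddCommGroup M] [Module k M]
    (hM : IsProgenerator k M) :
    ∃ t : Finset (M × Module.Dual k M), ∑ x ∈ t, x.2 x.1 = 1 := by
  have := hM.finite
  have := hM.projective
  obtain ⟨n, e, f, hef⟩ := exists_dual_basis (k := k) M
  let ev : M ⊗[k] Module.Dual k M →ₗ[k] k := TensorProduct.lift (Module.Dual.eval k M)
  have htop : LinearMap.range ev = ⊤ := by
    refine hM.eq_top_of_smul_eq_top (I := LinearMap.range ev) (top_le_iff.1 fun x _ => ?_)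
    rw [← hef x]
    exact Submodule.sum_mem _ fun i _ => Submodule.smul_mem_smul ⟨x ⊗ₜ f i, rfl⟩ trivial
  obtain ⟨z, hz⟩ := LinearMap.range_eq_top.1 htop 1
  obtain ⟨t, rfl⟩ := TensorProduct.exists_finset z
  exact ⟨t, by rw [← hz, map_sum]; rfl⟩

/-- Multiplication by `r - s` on `k` vanishes after tensoring with `M`, hence vanishes. -/
theorem faithfulSMul_of_faithfullyFlat (M : Type*) [AddCommGroup M] [Module k M]
    [Module.FaithfullyFlat k M] : FaithfulSMul k M := by
  refine ⟨fun {r s} h => ?_⟩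
  have h0 : LinearMap.lsmul k k (r - s) = 0 := by
    rw [Module.FaithfullyFlat.zero_iff_lTensor_zero k M]
    ext m
    simp only [TensorProduct.AlgebraTensorModule.curry_apply, LinearMap.restrictScalars_self,
      TensorProduct.curry_apply, LinearMap.lTensor_tmul, LinearMap.lsmul_apply,
      LinearMap.zero_apply]
    rw [TensorProduct.tmul_smul, TensorProduct.smul_tmul', sub_smul, h m, sub_self,
      TensorProduct.zero_tmul]
  simpa [sub_eq_zero] using LinearMap.congr_fun h0 1

/-- Finite generation descends along a faithfully flat, possibly noncommutative, algebra. -/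
theorem finite_of_finite_tensorProduct (T : Type*) [Ring T] [Algebra k T] {M : Type*}
    [AddCommGroup M] [Module k M] [Module.FaithfullyFlat k T] [Module.Finite T (T ⊗[k] M)] :
    Module.Finite k M := by
  obtain ⟨n, s, hs⟩ := Module.Finite.exists_fin (R := T) (M := T ⊗[k] M)
  -- Finitely many `m i j ∈ M` occur in the generators. They generate `M`, because the map they
  -- define is surjective after tensoring with `T`.
  choose κ t m h using fun i : Fin n ↦ TensorProduct.exists_sum_tmul_eq (s i)
  let f : ((Σ i, Fin (κ i)) →₀ k) →ₗ[k] M := Finsupp.linearCombination k fun ij ↦ m ij.1 ij.2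
  refine Module.Finite.of_surjective f ?_
  rw [← Module.FaithfullyFlat.lTensor_surjective_iff_surjective k T]
  change Function.Surjective (f.baseChange T)
  rw [← LinearMap.range_eq_top, ← top_le_iff, ← hs, Submodule.span_le]
  rintro _ ⟨i, rfl⟩
  rw [h]
  refine Submodule.sum_mem _ fun j _ => ?_
  exact ⟨t i j ⊗ₜ Finsupp.single ⟨i, j⟩ 1, by simp [f]⟩

/-- Finite generation together with projectivity descends along a faithfully flat, possibly
noncommutative, algebra. -/
theorem finite_projective_of_tensorProduct (T : Type*) [Ring T] [Algebra k T] {M : Type*}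
    [AddCommGroup M] [Module k M] [Module.FaithfullyFlat k T] [Module.Flat k M]
    [Module.Finite T (T ⊗[k] M)] [Module.Projective T (T ⊗[k] M)] :
    Module.Finite k M ∧ Module.Projective k M := by
  have hfin : Module.Finite k M := finite_of_finite_tensorProduct T
  -- The kernel of `T ⊗ l` is finitely generated, since `T ⊗ M` is finitely presented. Flatness of
  -- `T` identifies it with `T ⊗ ker l`, so `ker l` is finitely generated by descent, and a finitely
  -- presented flat module is projective.
  obtain ⟨n, l, hl⟩ := Module.Finite.exists_fin' k M
  have hfp : Module.FinitePresentation T (T ⊗[k] M) := Module.finitePresentation_of_projective _ _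
  have hker : (LinearMap.ker (l.baseChange T)).FG :=
    Module.FinitePresentation.fg_ker _ (LinearMap.lTensor_surjective T hl)
  have hrange : LinearMap.range ((LinearMap.ker l).subtype.baseChange T) =
      LinearMap.ker (l.baseChange T) := by
    ext x
    exact ((lTensor_exact T (LinearMap.exact_subtype_ker_map l) hl) x).symm
  have hinj : Function.Injective ((LinearMap.ker l).subtype.baseChange T) :=
    Module.Flat.lTensor_preserves_injective_linearMap _ (Submodule.subtype_injective _)
  have hfinrange : Module.Finite T (LinearMap.range ((LinearMap.ker l).subtype.baseChange T)) := by
    rw [hrange]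
    exact Module.Finite.of_fg hker
  have : Module.Finite T (T ⊗[k] LinearMap.ker l) :=
    Module.Finite.equiv (LinearEquiv.ofInjective _ hinj).symm
  have hk : Module.Finite k (LinearMap.ker l) := finite_of_finite_tensorProduct T
  have : Module.FinitePresentation k M :=
    Module.finitePresentation_of_surjective l hl (Module.Finite.iff_fg.1 hk)
  exact ⟨hfin, Module.Flat.projective_of_finitePresentation⟩

end ModuleTheory

/-! ### Surjectivity implies injectivity in a Morita context -/

section MoritaTheory

variable {k S P Q : Type*} [CommRing k] [Ring S] [AddCommGroup P] [Module k P]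
  [Module Sᵐᵒᵖ P] [AddCommGroup Q] [Module k Q] [Module S Q]

theorem BalancedTensor.op_smul_tmul (p : P) (s : S) (q : Q) :
    BalancedTensor.tmul k S (MulOpposite.op s • p) q = BalancedTensor.tmul k S p (s • q) :=
  (Submodule.Quotient.eq _).2 (Submodule.subset_span ⟨p, s, q, rfl⟩)

theorem BalancedTensor.exists_finset (z : BalancedTensor k S P Q) :
    ∃ t : Finset (P × Q), z = ∑ x ∈ t, BalancedTensor.tmul k S x.1 x.2 := by
  obtain ⟨z, rfl⟩ := Submodule.Quotient.mk_surjective _ z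
  obtain ⟨t, rfl⟩ := TensorProduct.exists_finset z
  exact ⟨t, map_sum (Submodule.mkQ _) _ _⟩

variable [Algebra k S] [IsScalarTower k Sᵐᵒᵖ P] [IsScalarTower k S Q] (M : MoritaContext k S P Q)

/-- If `∑ τ(pᵢ ⊗ qᵢ) = 1`, then `p ⊗ q = ∑ p ⊗ μ(q ⊗ pᵢ) qᵢ = ∑ p μ(q ⊗ pᵢ) ⊗ qᵢ = τ(p ⊗ q) ∑ pᵢ ⊗
qᵢ`, so `z` is recovered from `τ z`. -/
theorem MoritaContext.τ_injective (hτ : Function.Surjective M.τ) : Function.Injective M.τ := by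
  obtain ⟨c, hc⟩ := hτ 1
  obtain ⟨t, rfl⟩ := BalancedTensor.exists_finset c
  have smul_tmul (r : k) (p : P) (q : Q) :
      BalancedTensor.tmul k S (r • p) q = r • BalancedTensor.tmul k S p q := by
    simp only [BalancedTensor.tmul, ← TensorProduct.smul_tmul', Submodule.Quotient.mk_smul]
    rfl
  have tmul_sum (p : P) (g : P × Q → Q) :
      BalancedTensor.tmul k S p (∑ x ∈ t, g x) = ∑ x ∈ t, BalancedTensor.tmul k S p (g x) := by
    simp only [BalancedTensor.tmul, TensorProduct.tmul_sum]
    exact map_sum (Submodule.mkQ _) _ _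
  have key (z : BalancedTensor k S P Q) :
      z = M.τ z • ∑ x ∈ t, BalancedTensor.tmul k S x.1 x.2 := by
    obtain ⟨s, rfl⟩ := BalancedTensor.exists_finset z
    rw [map_sum, Finset.sum_smul]
    refine Finset.sum_congr rfl fun x _ => ?_
    conv_lhs => rw [← one_smul k x.2, ← hc, map_sum, Finset.sum_smul, tmul_sum]
    rw [Finset.smul_sum]
    refine Finset.sum_congr rfl fun y _ => ?_
    rw [← M.μ_smul, ← BalancedTensor.op_smul_tmul, ← M.τ_smul, smul_tmul]
  intro x y h
  rw [key x, key y, h]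

/-- If `∑ μ(qᵢ ⊗ pᵢ) = 1`, the same exchange gives `z = ∑ μ(z) qᵢ ⊗ pᵢ`. -/
theorem MoritaContext.μ_injective (hμ : Function.Surjective M.μ) : Function.Injective M.μ := by
  obtain ⟨c, hc⟩ := hμ 1
  obtain ⟨t, rfl⟩ := TensorProduct.exists_finset c
  have key (z : Q ⊗[k] P) : z = ∑ x ∈ t, (M.μ z • x.1) ⊗ₜ[k] x.2 := by
    induction z with
    | zero => simp
    | add z z' hz hz' =>
      simp only [map_add, add_smul, TensorProduct.add_tmul, Finset.sum_add_distrib, ← hz, ← hz']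
    | tmul q p =>
      conv_lhs => rw [← one_smul Sᵐᵒᵖ p, ← MulOpposite.op_one, ← hc, map_sum,
        Finset.op_sum, Finset.sum_smul, TensorProduct.tmul_sum]
      refine Finset.sum_congr rfl fun x _ => ?_
      rw [← M.τ_smul, M.μ_smul, TensorProduct.tmul_smul, TensorProduct.smul_tmul']
  intro x y h
  rw [key x, key y, h]

end MoritaTheory

end HopfGalois

namespace HopfGalois

/-! ### The duality between `can'` and `*can'`, and strictness of the Morita context -/

section SmashProduct

variable {k : Type u} {H : Type v} {A : Type w} [CommRing k] [Ring H] [Bialgebra k H] [Ring A]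
  [Algebra k A]

theorem Smash.mk_add (p : Module.Dual k H) (a b : A) :
    Smash.mk k p (a + b) = Smash.mk k p a + Smash.mk k p b := TensorProduct.tmul_add _ _ _

theorem Smash.mk_smul (p : Module.Dual k H) (r : k) (a : A) :
    Smash.mk k p (r • a) = r • Smash.mk k p a := TensorProduct.tmul_smul _ _ _

theorem Smash.smul_mk (p : Module.Dual k H) (r : k) (a : A) :
    Smash.mk k (r • p) a = r • Smash.mk k p a := (TensorProduct.smul_tmul' _ _ _).symm

theorem Smash.mk_zero (p : Module.Dual k H) : Smash.mk k p (0 : A) = 0 :=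
  TensorProduct.tmul_zero _ _

theorem Smash.sum_mk {ι : Type*} (s : Finset ι) (p : ι → Module.Dual k H) (a : A) :
    Smash.mk k (∑ i ∈ s, p i) a = ∑ i ∈ s, Smash.mk k (p i) a := TensorProduct.sum_tmul _ _ _

theorem twist_mk_counit (t : A ⊗[k] H) (a : A) :
    twist k H A t (Smash.mk k Coalgebra.counit a) =
      Smash.mk k Coalgebra.counit
        (TensorProduct.rid k A ((Coalgebra.counit (R := k) (A := H)).lTensor A t) * a) := by
  induction t with
  | zero => simp [Smash.mk_zero]
  | add x y hx hy => simp only [map_add, LinearMap.add_apply, hx, hy, add_mul, Smash.mk_add]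
  | tmul b g =>
    have : trans k H g Coalgebra.counit =
        (Coalgebra.counit g : k) • (Coalgebra.counit : H →ₗ[k] k) := by
      ext h; simp [mul_comm]
    rw [twist_tmul_mk, this, Smash.smul_mk]
    simp only [LinearMap.lTensor_tmul, TensorProduct.rid_tmul, smul_mul_assoc, Smash.mk_smul]

theorem evalSmash_smul (a : A) (z : A ⊗[k] H) (y : Smash k H A) :
    evalSmash k H A (a • z) y = a * evalSmash k H A z y := by
  induction z with
  | zero => simp
  | add z z' hz hz' => simp only [smul_add, map_add, LinearMap.add_apply, mul_add, hz, hz']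
  | tmul b h =>
    induction y using Smash.induction with
    | zero => simp
    | add x y hx hy => simp only [map_add, mul_add, hx, hy]
    | mk p c => simp [TensorProduct.smul_tmul', mul_assoc]

theorem evalSmash_mk_one (z : A ⊗[k] H) (p : Module.Dual k H) :
    evalSmash k H A z (Smash.mk k p 1) = TensorProduct.rid k A (LinearMap.lTensor A p z) := by
  induction z with
  | zero => simp
  | add z z' hz hz' => simp only [map_add, LinearMap.add_apply, hz, hz']
  | tmul b h => simp

/-- An element of `H* # A` is determined by its pairings with the `1 ⊗ eᵢ`: this is the coordinate
form of `H* ⊗ A ≅ Hom_A(A ⊗ H, A)`. -/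
theorem Smash.eq_sum_mk_evalSmash {n : ℕ} {e : Fin n → H} {f : Fin n → Module.Dual k H}
    (hef : ∀ x, ∑ i, f i x • e i = x) (y : Smash k H A) :
    y = ∑ i, Smash.mk k (f i) (evalSmash k H A (1 ⊗ₜ e i) y) := by
  induction y using Smash.induction with
  | zero => simp [Smash.mk_zero]
  | add x y hx hy => simp only [map_add, Smash.mk_add, Finset.sum_add_distrib, ← hx, ← hy]
  | mk p c =>
    have hp : p = ∑ i, p (e i) • f i := by
      ext x
      conv_lhs => rw [← hef x]
      simp [mul_comm]
    conv_lhs => rw [hp]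
    simp [Smash.sum_mk, Smash.smul_mk, Smash.mk_smul]

theorem tensor_ext_evalSmash (hH : IsProgenerator k H) {z z' : A ⊗[k] H}
    (h : ∀ y, evalSmash k H A z y = evalSmash k H A z' y) : z = z' := by
  refine tensor_ext_of_projective hH.projective hH.finite fun p => ?_
  apply (TensorProduct.rid k A).injective
  rw [← evalSmash_mk_one, ← evalSmash_mk_one, h]

variable [ComoduleAlgebra k H A]

theorem mk_mul_mk_counit (p : Module.Dual k H) (b a : A) :
    Smash.mk k p b * Smash.mk k Coalgebra.counit a = Smash.mk k p (b * a) := by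
  rw [smash_mul_def, smashMul_mk, twist_mk_counit, convRight_mk, counit_conv,
    ComoduleAlgebra.counit_coaction]

theorem mk_counit_mul (b : A) (y : Smash k H A) :
    Smash.mk k Coalgebra.counit b * y = twist k H A (rho k H A b) y := by
  rw [smash_mul_def, smashMul_mk, convRight_counit]

theorem mk_one_mul_mk_one (p q : Module.Dual k H) :
    Smash.mk k p (1 : A) * Smash.mk k q 1 = Smash.mk k (conv k H q p) 1 := by
  rw [smash_mul_def, smashMul_mk, map_one, twist_one, convRight_mk]

theorem evalSmash_mul_mk_counit (z : A ⊗[k] H) (y : Smash k H A) (a : A) :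
    evalSmash k H A z (y * Smash.mk k Coalgebra.counit a) = evalSmash k H A z y * a := by
  induction y using Smash.induction with
  | zero => simp
  | add x y hx hy => simp only [add_mul, map_add, hx, hy]
  | mk p c =>
    rw [mk_mul_mk_counit]
    induction z with
    | zero => simp
    | add z z' hz hz' => simp only [map_add, LinearMap.add_apply, add_mul, hz, hz']
    | tmul b h => simp [mul_assoc]

theorem starCanLin_mul_mk_counit (y : Smash k H A) (a c : A) :
    starCanLin k H A (y * Smash.mk k Coalgebra.counit a) c = starCanLin k H A y c * a :=
  evalSmash_mul_mk_counit _ _ _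

theorem can_smul (a : A) (t : A ⊗[k] A) : can k H A (a • t) = a • can k H A t := by
  have smul_mul' (z z' : A ⊗[k] H) : (a • z) * z' = a • (z * z') := smul_mul_assoc a z z'
  induction t with
  | zero => simp
  | add x y hx hy => simp only [smul_add, map_add, hx, hy]
  | tmul b c =>
    rw [TensorProduct.smul_tmul', can_tmul, can_tmul, ← smul_mul', TensorProduct.smul_tmul']

/-- The key identity: relative to the pairing of `A ⊗ H` with `H* # A`, the map `*can'` is the left
`A`-dual of `can'`. -/
theorem evalSmash_can_tmul (a c : A) (y : Smash k H A) :
    evalSmash k H A (can k H A (a ⊗ₜ c)) y = a * starCanLin k H A y c := by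
  have : a ⊗ₜ[k] c = a • ((1 : A) ⊗ₜ[k] c) := by
    rw [TensorProduct.smul_tmul', smul_eq_mul, mul_one]
  rw [this, can_smul, evalSmash_smul, can_tmul, ← Algebra.TensorProduct.one_def, one_mul]
  rfl

theorem bijective_starCan_iff :
    Function.Bijective (starCan k H A) ↔ Function.Bijective (starCanLin k H A) :=
  (MulOpposite.opEquiv (α := Module.End k A)).comp_bijective (starCanLin k H A)

/-- The dual of an isomorphism is an isomorphism; the dual basis of `H` makes the identification of
duals explicit. -/
theorem bijective_starCanLin_of_bijective_can (hH : IsProgenerator k H)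
    (h : Function.Bijective (can k H A)) : Function.Bijective (starCanLin k H A) := by
  have := hH.finite
  have := hH.projective
  obtain ⟨n, e, f, hef⟩ := exists_dual_basis (k := k) H
  constructor
  · rw [← LinearMap.ker_eq_bot, LinearMap.ker_eq_bot']
    intro y hy
    -- An element acting by zero pairs to zero with the image of `can'`, hence with every `1 ⊗ eᵢ`.
    have key (t : A ⊗[k] A) : evalSmash k H A (can k H A t) y = 0 := by
      induction t with
      | zero => simp
      | add x y hx hy => simp only [map_add, LinearMap.add_apply, hx, hy, add_zero]
      | tmul a c => rw [evalSmash_can_tmul, hy, LinearMap.zero_apply, mul_zero]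
    rw [Smash.eq_sum_mk_evalSmash hef y]
    refine Finset.sum_eq_zero fun i _ => ?_
    obtain ⟨t, ht⟩ := h.2 ((1 : A) ⊗ₜ e i)
    rw [← ht, key, Smash.mk_zero]
  · intro φ
    let E : (A ⊗[k] A) ≃ₗ[k] A ⊗[k] H := LinearEquiv.ofBijective (can k H A) h
    -- `Φ(a ⊗ c) = a φ(c)` is the left `A`-linear form attached to `φ`. Composed with the inverse of
    -- `can'`, it becomes a form on `A ⊗ H`, whose coordinates define `y`.
    let Φ : A ⊗[k] A →ₗ[k] A := TensorProduct.lift ((LinearMap.mul k A).compl₂ φ)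
    have hΦ (a : A) (t : A ⊗[k] A) : Φ (a • t) = a * Φ t := by
      induction t with
      | zero => simp
      | add x y hx hy => simp only [smul_add, map_add, mul_add, hx, hy]
      | tmul b c => simp [Φ, TensorProduct.smul_tmul', mul_assoc]
    have hE (a : A) (z : A ⊗[k] H) : E.symm (a • z) = a • E.symm z := by
      rw [LinearEquiv.symm_apply_eq]
      exact (congrArg (a • ·) (E.apply_symm_apply z).symm).trans (can_smul a (E.symm z)).symm
    let y : Smash k H A := ∑ i, Smash.mk k (f i) (Φ (E.symm (1 ⊗ₜ e i)))
    have key (z : A ⊗[k] H) : evalSmash k H A z y = Φ (E.symm z) := by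
      induction z with
      | zero => simp
      | add z z' hz hz' => simp only [map_add, LinearMap.add_apply, hz, hz']
      | tmul a x =>
        have hax : a ⊗ₜ[k] x = a • ∑ i, f i x • ((1 : A) ⊗ₜ[k] e i) := by
          conv_lhs => rw [← hef x]
          simp [TensorProduct.tmul_sum, Finset.smul_sum, TensorProduct.smul_tmul']
        conv_rhs => rw [hax, hE, hΦ]
        simp [y, Finset.mul_sum]
    refine ⟨y, LinearMap.ext fun c => ?_⟩
    have hc : rho k H A c = E (1 ⊗ₜ c) := by
      change _ = can k H A (1 ⊗ₜ c)
      rw [can_tmul, ← Algebra.TensorProduct.one_def, one_mul]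
    rw [starCanLin_apply, key, hc, LinearEquiv.symm_apply_apply]
    simp [Φ]

/-- The element of `H* # A` that acts on `A` as `c ↦ ⟨β, c⟩ 1`. -/
theorem exists_starCanLin_eq_dual (h : Function.Surjective (starCanLin k H A))
    (β : Module.Dual k A) : ∃ y, ∀ c, starCanLin k H A y c = algebraMap k A (β c) := by
  obtain ⟨y, hy⟩ := h (Algebra.linearMap k A ∘ₗ β)
  exact ⟨y, fun c => by rw [hy]; rfl⟩

/-- Both sides act on `c` alike: the left side gives `∑ βᵢ(c) (bᵢ · y)`, which is `c · y` by
linearity. -/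
theorem sum_mul_mk_counit_eq (h : Function.Injective (starCanLin k H A)) {n : ℕ} {b : Fin n → A}
    {β : Fin n → Module.Dual k A} (hb : ∀ x, ∑ i, β i x • b i = x) {q : Fin n → Smash k H A}
    (hq : ∀ i c, starCanLin k H A (q i) c = algebraMap k A (β i c)) (y : Smash k H A) :
    ∑ i, q i * Smash.mk k Coalgebra.counit (starCanLin k H A y (b i)) = y := by
  refine h (LinearMap.ext fun c => ?_)
  conv_rhs => rw [← hb c]
  simp [starCanLin_mul_mk_counit, hq, Algebra.algebraMap_eq_smul_one]

theorem bijective_can_of_bijective_starCanLin (hH : IsProgenerator k H) (hA : IsProgenerator k A)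
    (h : Function.Bijective (starCanLin k H A)) : Function.Bijective (can k H A) := by
  have := hA.finite
  have := hA.projective
  obtain ⟨n, b, β, hb⟩ := exists_dual_basis (k := k) A
  choose q hq using fun i => exists_starCanLin_eq_dual h.2 (β i)
  -- The candidate inverse of `can'`. On `can'(a ⊗ c)` it gives `∑ a βᵢ(c) ⊗ bᵢ = a ⊗ c`; the other
  -- composite is tested by pairing with every `y`.
  let G (z : A ⊗[k] H) : A ⊗[k] A := ∑ i, evalSmash k H A z (q i) ⊗ₜ b i
  refine Function.bijective_iff_has_inverse.2 ⟨G, fun t => ?_, fun z => ?_⟩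
  · have hG (z z') : G (z + z') = G z + G z' := by
      simp [G, TensorProduct.add_tmul, Finset.sum_add_distrib]
    induction t with
    | zero => simp [G]
    | add x y hx hy => rw [map_add, hG, hx, hy]
    | tmul a c =>
      conv_rhs => rw [← hb c, TensorProduct.tmul_sum]
      refine Finset.sum_congr rfl fun i _ => ?_
      rw [evalSmash_can_tmul, hq, ← Algebra.commutes, ← Algebra.smul_def, TensorProduct.smul_tmul]
  · refine tensor_ext_evalSmash hH fun y => ?_
    simp only [G, map_sum, LinearMap.sum_apply, evalSmash_can_tmul]
    conv_rhs => rw [← sum_mul_mk_counit_eq h.1 hb hq y, map_sum]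
    simp only [evalSmash_mul_mk_counit]

/-- As `can'` is left `A`-linear, `A ⊗ A ≅ A ⊗ H` is finitely generated projective over `A`. Descent
then applies with `A` both as the base algebra and as the module. -/
theorem isProgenerator_of_bijective_can (hH : IsProgenerator k H)
    (h : Function.Bijective (can k H A)) (hA : Module.FaithfullyFlat k A) :
    IsProgenerator k A := by
  have := hH.finite
  have := hH.projective
  let e : (A ⊗[k] A) ≃ₗ[A] A ⊗[k] H :=
    LinearEquiv.ofBijective
      { toFun := can k H A
        map_add' := map_add _
        map_smul' := can_smul } h
  have : Module.Finite A (A ⊗[k] A) := Module.Finite.equiv e.symm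
  have : Module.Projective A (A ⊗[k] A) := Module.Projective.of_equiv e.symm
  obtain ⟨h1, h2⟩ := finite_projective_of_tensorProduct A (k := k) (M := A)
  exact ⟨h1, h2, faithfulSMul_of_faithfullyFlat A⟩

theorem rho_mul_of_mem {a : A} (ha : a ∈ coinvariants k H A) (c : A) :
    rho k H A (a * c) = a • rho k H A c := by
  rw [map_mul (rho k H A), mem_coinvariants.1 ha]
  have : a ⊗ₜ[k] (1 : H) = a • (1 : A ⊗[k] H) := by
    rw [Algebra.TensorProduct.one_def, TensorProduct.smul_tmul', smul_eq_mul, mul_one]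
  rw [this]
  exact (smul_mul_assoc a 1 (rho k H A c)).trans (by rw [one_mul])

/-- Every `*can'(y)` commutes with left multiplication by a coinvariant `a`. Applied to `c ↦ β(c) 1`
this gives `a β(x) = β(a x)`; summing over `∑ β(x) = 1` yields `a = ∑ β(a x)`, a scalar. -/
theorem coinvariantsEqBase_of_surjective (hA : IsProgenerator k A)
    (h : Function.Surjective (starCanLin k H A)) : CoinvariantsEqBase k H A := by
  have := hA.faithful
  constructor
  · intro r s hrs
    have hrs' : algebraMap k A r = algebraMap k A s := congrArg Subtype.val hrs
    exact FaithfulSMul.eq_of_smul_eq_smul (α := A) fun a => by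
      rw [Algebra.smul_def, Algebra.smul_def, hrs']
  · rintro ⟨a, ha⟩
    obtain ⟨t, ht⟩ := hA.exists_sum_dual_eq_one
    refine ⟨∑ x ∈ t, x.2 (a * x.1), Subtype.ext ?_⟩
    change algebraMap k A _ = a
    conv_rhs => rw [← mul_one a, ← map_one (algebraMap k A), ← ht]
    rw [map_sum, map_sum, Finset.mul_sum]
    refine Finset.sum_congr rfl fun x _ => ?_
    obtain ⟨y, hy⟩ := exists_starCanLin_eq_dual h x.2
    rw [← hy, ← hy, starCanLin_apply, rho_mul_of_mem ha, evalSmash_smul, starCanLin_apply]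

/-- The values of `y` are scalars, on which `p` acts by `⟨p, 1⟩`; injectivity lifts this from the
action to `H* # A`. -/
theorem mem_Q_of_starCanLin_eq_dual (h : Function.Injective (starCanLin k H A))
    {β : Module.Dual k A} {y : Smash k H A}
    (hy : ∀ c, starCanLin k H A y c = algebraMap k A (β c)) : y ∈ Q k H A := by
  refine mem_Q.2 fun p => h (LinearMap.ext fun c => ?_)
  rw [starCanLin_mul, Module.End.mul_apply, starCanLin_mk, hy, mul_one, map_smul,
    LinearMap.smul_apply, hy, Algebra.algebraMap_eq_smul_one, map_smul]
  change _ • TensorProduct.rid k A (LinearMap.lTensor A p (rho k H A 1)) = _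
  rw [map_one, Algebra.TensorProduct.one_def, LinearMap.lTensor_tmul, TensorProduct.rid_tmul,
    smul_comm]

/-- The trace ideal handles `τ`, the dual basis handles `μ`, and injectivity is automatic in a
Morita context. -/
theorem moritaContext_isStrict (hH : IsProgenerator k H) (hA : IsProgenerator k A)
    (h : Function.Bijective (starCanLin k H A)) (hco : CoinvariantsEqBase k H A) :
    (moritaContext hH hco).IsStrict := by
  have := hA.finite
  have := hA.projective
  have hτ : Function.Surjective (moritaContext hH hco).τ := by
    have hτ' (a : A) (y : Q k H A) : algebraMap k A ((moritaContext hH hco).τ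
        (BalancedTensor.tmul k (Smash k H A) a y)) = starCanLin k H A y a :=
      hco.algebraMap_equiv_symm _
    have hinj : Function.Injective (algebraMap k A) := fun r s hrs => hco.1 (Subtype.ext hrs)
    obtain ⟨t, ht⟩ := hA.exists_sum_dual_eq_one
    choose q hq using fun β => exists_starCanLin_eq_dual h.2 (β : Module.Dual k A)
    have h1 : (moritaContext hH hco).τ (∑ x ∈ t, BalancedTensor.tmul k (Smash k H A) x.1
        ⟨q x.2, mem_Q_of_starCanLin_eq_dual h.1 (hq x.2)⟩) = 1 := by
      rw [← ht, map_sum]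
      refine Finset.sum_congr rfl fun x _ => hinj ?_
      rw [hτ', hq]
    exact fun r => ⟨r • _, by rw [map_smul, h1, smul_eq_mul, mul_one]⟩
  have hμ : Function.Surjective (moritaContext hH hco).μ := by
    obtain ⟨n, b, β, hb⟩ := exists_dual_basis (k := k) A
    choose q hq using fun i => exists_starCanLin_eq_dual h.2 (β i)
    intro y
    refine ⟨∑ i, (⟨q i, mem_Q_of_starCanLin_eq_dual h.1 (hq i)⟩ : Q k H A) ⊗ₜ
      starCanLin k H A y (b i), ?_⟩
    rw [map_sum]
    exact sum_mul_mk_counit_eq h.1 hb hq y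
  exact ⟨⟨MoritaContext.τ_injective _ hτ, hτ⟩, ⟨MoritaContext.μ_injective _ hμ, hμ⟩⟩

/-- This is the converse direction of Morita theory: all conclusions are read off from one
expression `1 = ∑ μ(qₓ ⊗ aₓ)`. -/
theorem bijective_starCanLin_of_mu_surjective (hH : IsProgenerator k H)
    (hco : CoinvariantsEqBase k H A) (hμ : Function.Surjective (mu k H A)) :
    Function.Bijective (starCanLin k H A) ∧ IsProgenerator k A := by
  let M := moritaContext hH hco
  obtain ⟨z, hz⟩ := hμ 1
  obtain ⟨t, rfl⟩ := TensorProduct.exists_finset z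
  have hz' : ∑ x ∈ t, M.μ (x.1 ⊗ₜ x.2) = 1 := by rw [← map_sum]; exact hz
  -- The `aₓ` with the functionals `τ(- ⊗ qₓ)` form a dual basis of `A`. Consequently `φ` is the
  -- action of `∑ μ(qₓ ⊗ φ(aₓ))`.
  have hτ (a : A) : ∑ x ∈ t, M.τ (BalancedTensor.tmul k (Smash k H A) a x.1) • x.2 = a := by
    simp only [M.τ_smul]
    rw [← Finset.sum_smul, ← Finset.op_sum, hz', MulOpposite.op_one, one_smul]
  refine ⟨⟨?_, fun φ => ⟨∑ x ∈ t, M.μ (x.1 ⊗ₜ φ x.2), LinearMap.ext fun a => ?_⟩⟩, ?_⟩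
  · rw [← LinearMap.ker_eq_bot, LinearMap.ker_eq_bot']
    intro y hy
    -- `y = ∑ μ(qₓ ⊗ aₓ) y = ∑ μ(qₓ ⊗ aₓ · y)`, which vanishes when `y` acts by zero.
    rw [← one_mul y, ← hz', Finset.sum_mul]
    refine Finset.sum_eq_zero fun x _ => ?_
    rw [← M.μ_smul_right, op_smul_def, hy, LinearMap.zero_apply, TensorProduct.tmul_zero, map_zero]
  · conv_rhs => rw [← hτ a, map_sum]
    rw [map_sum, LinearMap.sum_apply]
    refine Finset.sum_congr rfl fun x _ => ?_
    rw [map_smul, M.τ_smul]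
    rfl
  · let f (x : t) : Module.Dual k A :=
      M.τ ∘ₗ Submodule.mkQ _ ∘ₗ (TensorProduct.mk k A (Q k H A)).flip x.1.1
    obtain ⟨h1, h2⟩ := finite_projective_of_dual_basis (fun x : t => x.1.2) f fun a =>
      (Finset.sum_coe_sort t fun x => M.τ (BalancedTensor.tmul k (Smash k H A) a x.1) • x.2).trans
        (hτ a)
    refine ⟨h1, h2, ⟨fun {r s} hrs => hco.1 (Subtype.ext ?_)⟩⟩
    change algebraMap k A r = algebraMap k A s
    rw [Algebra.algebraMap_eq_smul_one, Algebra.algebraMap_eq_smul_one, hrs]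

end SmashProduct

end HopfGalois

namespace HopfGalois

/-- With a dual basis of `H`, an element of `M ⊗ H` is rebuilt from its slices along the `fᵢ`.
Identities of coactions can therefore be checked against `H*`. -/
theorem tensor_ext_dual {k H M : Type*} [CommRing k] [AddCommGroup H] [Module k H]
    [Module.Finite k H] [Module.Projective k H] [AddCommGroup M] [Module k M] {z z' : M ⊗[k] H}
    (h : ∀ p : Module.Dual k H, TensorProduct.rid k M (LinearMap.lTensor M p z) =
      TensorProduct.rid k M (LinearMap.lTensor M p z')) : z = z' := by
  obtain ⟨n, e, f, hef⟩ := exists_dual_basis (k := k) H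
  have key (z : M ⊗[k] H) :
      z = ∑ i, TensorProduct.rid k M (LinearMap.lTensor M (f i) z) ⊗ₜ e i := by
    induction z with
    | zero => simp
    | add x y hx hy =>
      simp only [map_add, TensorProduct.add_tmul, Finset.sum_add_distrib, ← hx, ← hy]
    | tmul m x =>
      conv_lhs => rw [← hef x, TensorProduct.tmul_sum]
      simp [TensorProduct.smul_tmul]
  rw [key z, key z']
  simp only [h]

namespace RelHopfModule

open CategoryTheory

/-! ### Relative Hopf modules as right modules over the smash product -/

section SmashAction

variable {k H A : Type u} [CommRing k] [Ring H] [Bialgebra k H] [Ring A]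
  [Algebra k A] [ComoduleAlgebra k H A] (M : RelHopfModule k H A)

/-- The right action `(m, a) ↦ m a` of `A` on a relative Hopf module. -/
noncomputable abbrev rightAct : M.carrier →ₗ[k] A →ₗ[k] M.carrier :=
  ((Algebra.lsmul k k M.carrier).toLinearMap ∘ₗ
    (MulOpposite.opLinearEquiv k : A ≃ₗ[k] Aᵐᵒᵖ).toLinearMap).flip

/-- The pairing `(m ⊗ h) (q # b) = ⟨q, h⟩ m b`. -/
noncomputable def evalAct : M.carrier ⊗[k] H →ₗ[k] Smash k H A →ₗ[k] M.carrier :=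
  ((TensorProduct.map₂ (Module.Dual.eval k H) M.rightAct :
    H ⊗[k] M.carrier →ₗ[k] Module.Dual k H ⊗[k] A →ₗ[k] k ⊗[k] M.carrier).compr₂
      (TensorProduct.lid k M.carrier).toLinearMap) ∘ₗ
        (TensorProduct.comm k M.carrier H).toLinearMap

@[simp] theorem evalAct_tmul_mk (m : M.carrier) (h : H) (q : Module.Dual k H) (b : A) :
    M.evalAct (m ⊗ₜ h) (Smash.mk k q b) = q h • MulOpposite.op b • m := rfl

/-- The right action of `H* # A` on a relative Hopf module, `m · (q # b) = ⟨q, m₁⟩ m₀ b`. -/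
noncomputable def act : M.carrier →ₗ[k] Smash k H A →ₗ[k] M.carrier :=
  M.evalAct ∘ₗ M.coaction

theorem act_apply (m : M.carrier) (y : Smash k H A) :
    M.act m y = M.evalAct (M.coaction m) y := rfl

theorem evalAct_mk (z : M.carrier ⊗[k] H) (p : Module.Dual k H) (b : A) :
    M.evalAct z (Smash.mk k p b) =
      MulOpposite.op b • TensorProduct.rid k M.carrier (LinearMap.lTensor M.carrier p z) := by
  induction z with
  | zero => simp
  | add z z' hz hz' => simp only [map_add, LinearMap.add_apply, smul_add, hz, hz']
  | tmul m h =>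
    rw [evalAct_tmul_mk, LinearMap.lTensor_tmul, TensorProduct.rid_tmul]
    exact smul_comm _ _ _

theorem act_mk (m : M.carrier) (p : Module.Dual k H) (b : A) :
    M.act m (Smash.mk k p b) = MulOpposite.op b • M.act m (Smash.mk k p 1) := by
  rw [act_apply, act_apply, evalAct_mk, evalAct_mk, MulOpposite.op_one, one_smul]

theorem act_one (m : M.carrier) : M.act m 1 = m := by
  rw [smash_one_def, act_apply, evalAct_mk, MulOpposite.op_one, one_smul]
  exact M.counit_coaction m

theorem evalAct_map₂ (z : M.carrier ⊗[k] H) (t : A ⊗[k] H) (y : Smash k H A) :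
    M.evalAct (TensorProduct.map₂ M.rightAct (LinearMap.mul k H) z t) y =
      M.evalAct z (twist k H A t y) := by
  induction y using Smash.induction with
  | zero => simp
  | add x y hx hy => simp only [map_add, hx, hy]
  | mk p b =>
    induction z with
    | zero => simp
    | add z z' hz hz' => simp only [map_add, LinearMap.add_apply, hz, hz']
    | tmul m h =>
      induction t with
      | zero => simp
      | add t t' ht ht' => simp only [map_add, LinearMap.add_apply, ht, ht']
      | tmul a g => simp [mul_smul]

/-- This is the compatibility `ρ(m a) = m₀ a₀ ⊗ m₁ a₁` seen through the action: it matches the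
product `(ε # a) y`. -/
theorem act_op_smul (m : M.carrier) (a : A) (y : Smash k H A) :
    M.act (MulOpposite.op a • m) y = M.act m (Smash.mk k Coalgebra.counit a * y) := by
  rw [act_apply, M.coaction_smul, evalAct_map₂, mk_counit_mul, act_apply]

/-- Coassociativity of the coaction of `M`, paired with two functionals, becomes compatibility with
convolution. -/
theorem act_act_mk_one (m : M.carrier) (p : Module.Dual k H) (y : Smash k H A) :
    M.act (M.act m (Smash.mk k p 1)) y = M.act m (Smash.mk k p 1 * y) := by
  have hp (y : Smash k H A) : Smash.mk k p 1 * y = convRight k H A p y := by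
    rw [smash_mul_def, smashMul_mk, map_one, twist_one]
  rw [hp]
  induction y using Smash.induction with
  | zero => simp
  | add x y hx hy => simp only [map_add, hx, hy]
  | mk q b =>
    rw [convRight_mk, M.act_mk _ q b, M.act_mk _ _ b]
    congr 1
    simp only [act_apply, evalAct_mk, MulOpposite.op_one, one_smul]
    -- `L` applies `p` to the last leg and `q` to the middle one, matching the order of `q * p`.
    let L : (M.carrier ⊗[k] H) ⊗[k] H →ₗ[k] M.carrier :=
      TensorProduct.rid k M.carrier ∘ₗ LinearMap.lTensor M.carrier q ∘ₗ
        TensorProduct.rid k (M.carrier ⊗[k] H) ∘ₗ LinearMap.lTensor (M.carrier ⊗[k] H) p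
    have e1 (z : M.carrier ⊗[k] H) : L (M.coaction.rTensor H z) =
        TensorProduct.rid k M.carrier (LinearMap.lTensor M.carrier q
          (M.coaction (TensorProduct.rid k M.carrier (LinearMap.lTensor M.carrier p z)))) := by
      induction z with
      | zero => simp
      | add x y hx hy => simp only [map_add, hx, hy]
      | tmul m h => simp [L]
    have e2 (z : M.carrier ⊗[k] H) : L ((TensorProduct.assoc k M.carrier H H).symm
        (Coalgebra.comul.lTensor M.carrier z)) =
        TensorProduct.rid k M.carrier (LinearMap.lTensor M.carrier (conv k H q p) z) := by
      induction z with
      | zero => simp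
      | add x y hx hy => simp only [map_add, hx, hy]
      | tmul m h =>
        simp only [LinearMap.lTensor_tmul, TensorProduct.rid_tmul, conv_apply]
        generalize (Coalgebra.comul h : H ⊗[k] H) = d
        induction d with
        | zero => simp
        | add x y hx hy => simp only [TensorProduct.tmul_add, map_add, add_smul, hx, hy]
        | tmul h h' => simp [L, mul_comm, mul_smul]
    rw [← e1, ← e2, ← M.coassoc, LinearEquiv.symm_apply_apply]

/-- Factoring `p # b = (p # 1)(ε # b)` reduces associativity to the two cases above. -/
theorem act_mul (m : M.carrier) (x y : Smash k H A) : M.act m (x * y) = M.act (M.act m x) y := by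
  induction x using Smash.induction with
  | zero => simp
  | add x z hx hz => simp only [add_mul, map_add, LinearMap.add_apply, hx, hz]
  | mk p b =>
    rw [← mk_counit_mul_mk, mul_assoc, ← act_act_mk_one, ← act_op_smul, ← act_mk,
      mk_counit_mul_mk]

theorem act_mul_mk_counit (m : M.carrier) (y : Smash k H A) (a : A) :
    M.act m (y * Smash.mk k Coalgebra.counit a) = MulOpposite.op a • M.act m y := by
  rw [act_mul, act_mk, ← smash_one_def, act_one]

variable {M}

theorem act_of_mem_coinv {m : M.carrier} (hm : m ∈ M.coinv) (y : Smash k H A) :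
    M.act m y = MulOpposite.op (starCanLin k H A y 1) • m := by
  rw [act_apply, mem_coinv.1 hm, starCanLin_apply, map_one, Algebra.TensorProduct.one_def]
  induction y using Smash.induction with
  | zero => simp
  | add x y hx hy => simp only [map_add, MulOpposite.op_add, add_smul, hx, hy]
  | mk p b => simp

/-- For coinvariant `m`, the map `a ↦ m a` from `A` to `M` is thus linear over `H* # A`. -/
theorem act_op_smul_of_mem_coinv {m : M.carrier} (hm : m ∈ M.coinv) (a : A) (y : Smash k H A) :
    M.act (MulOpposite.op a • m) y = MulOpposite.op (starCanLin k H A y a) • m := by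
  rw [act_op_smul, act_of_mem_coinv hm, starCanLin_mul, Module.End.mul_apply, starCanLin_mk]
  congr 3
  conv_rhs => rw [← one_mul a]
  congr 1
  exact ComoduleAlgebra.counit_coaction 1

theorem mem_coinv_iff_act (hH : IsProgenerator k H) {m : M.carrier} :
    m ∈ M.coinv ↔ ∀ p : Module.Dual k H, M.act m (Smash.mk k p 1) = p 1 • m := by
  have := hH.finite
  have := hH.projective
  simp only [act_apply, evalAct_mk, MulOpposite.op_one, one_smul]
  refine ⟨fun h p => by rw [mem_coinv.1 h]; simp, fun h => mem_coinv.2 ?_⟩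
  refine tensor_ext_dual fun p => (h p).trans ?_
  simp

/-- The defining relation of `Q` is exactly what turns `m · y` into a coinvariant. -/
theorem act_mem_coinv (hH : IsProgenerator k H) (m : M.carrier) {y : Smash k H A}
    (hy : y ∈ Q k H A) : M.act m y ∈ M.coinv := by
  rw [mem_coinv_iff_act hH]
  intro p
  rw [← act_mul, hy p, map_smul]

theorem induced_act {N : Type u} [AddCommGroup N] [Module k N]
    (x : (induced k H A N).carrier) (y : Smash k H A) :
    (induced k H A N).act x y = (starCanLin k H A y).lTensor N x := by
  have hsmul (a : A) (n : N) (b : A) : MulOpposite.op a •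
      (show (induced k H A N).carrier from n ⊗ₜ[k] b) = n ⊗ₜ[k] (b * a) := rfl
  refine TensorProduct.induction_on (motive := fun x : N ⊗[k] A =>
    (induced k H A N).act x y = (starCanLin k H A y).lTensor N x) x ?_ ?_ ?_
  · exact (LinearMap.congr_fun (map_zero (induced k H A N).act) y).trans (map_zero _).symm
  · intro n c
    have key (t : A ⊗[k] H) : (induced k H A N).evalAct
        ((TensorProduct.assoc k N A H).symm (n ⊗ₜ[k] t)) y = n ⊗ₜ[k] evalSmash k H A t y := by
      induction t with
      | zero =>
        simp only [TensorProduct.tmul_zero, map_zero, LinearMap.zero_apply]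
        rfl
      | add t t' ht ht' =>
        rw [TensorProduct.tmul_add, map_add, map_add, LinearMap.add_apply,
          TensorProduct.tmul_add]
        exact (LinearMap.congr_fun (map_add (induced k H A N).evalAct _ _) y).trans
          (congrArg₂ (· + ·) ht ht')
      | tmul a h =>
        induction y using Smash.induction with
        | zero =>
          simp only [map_zero, TensorProduct.tmul_zero]
          rfl
        | add y y' hy hy' =>
          simp only [TensorProduct.tmul_add, map_add]
          exact congrArg₂ (· + ·) hy hy'
        | mk p b =>
          rw [evalSmash_tmul_mk, TensorProduct.tmul_smul]
          rfl
    exact key _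
  · intro x x' hx hx'
    exact (LinearMap.congr_fun (map_add (induced k H A N).act x x') y).trans
      ((congrArg₂ (· + ·) hx hx').trans (map_add _ _ _).symm)

theorem isIso_of_bijective {M N : RelHopfModule k H A} (f : M ⟶ N)
    (h : Function.Bijective (Hom.toLinearMap f)) : IsIso f := by
  let e : M.carrier ≃ₗ[k] N.carrier := LinearEquiv.ofBijective (Hom.toLinearMap f) h
  have he : e.toLinearMap = Hom.toLinearMap f := rfl
  refine ⟨⟨⟨e.symm.toLinearMap, fun a n => ?_, fun n => ?_⟩, ?_, ?_⟩⟩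
  · obtain ⟨m, rfl⟩ := e.surjective n
    change e.symm (MulOpposite.op a • e m) = MulOpposite.op a • e.symm (e m)
    rw [e.symm_apply_apply, LinearEquiv.symm_apply_eq]
    exact (Hom.map_op_smul f a m).symm
  · obtain ⟨m, rfl⟩ := e.surjective n
    have h1 : N.coaction (e m) = e.toLinearMap.rTensor H (M.coaction m) := Hom.colinear f m
    rw [h1, ← LinearMap.rTensor_comp_apply]
    simp
  · exact hom_ext (LinearMap.ext fun m => e.symm_apply_apply m)
  · exact hom_ext (LinearMap.ext fun n => e.apply_symm_apply n)

end SmashAction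

/-! ### Strictness of the Morita context gives the equivalence of categories -/

section Equivalence

variable {k H A : Type u} [CommRing k] [Ring H] [Bialgebra k H] [Ring A]
  [Algebra k A] [ComoduleAlgebra k H A]

theorem counitHom_bijective (hH : IsProgenerator k H) (hco : CoinvariantsEqBase k H A)
    (hμ : Function.Surjective (mu k H A)) (M : RelHopfModule k H A) :
    Function.Bijective (counitHom M).toLinearMap := by
  obtain ⟨z, hz⟩ := hμ 1
  obtain ⟨t, rfl⟩ := TensorProduct.exists_finset z
  have hz' : ∑ x ∈ t, (x.1 : Smash k H A) * Smash.mk k Coalgebra.counit x.2 = 1 := by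
    rw [← hz, map_sum]; rfl
  -- The inverse `m ↦ ∑ m · qₓ ⊗ aₓ` of the counit, built from `1 = ∑ qₓ (ε # aₓ)`.
  let L : M.carrier →ₗ[k] M.coinv ⊗[k] A := ∑ x ∈ t, (TensorProduct.mk k M.coinv A).flip x.2 ∘ₗ
    (M.act.flip (x.1 : Smash k H A)).codRestrict M.coinv fun m => act_mem_coinv hH m x.1.2
  have hL (m : M.carrier) : L m = ∑ x ∈ t,
      (⟨M.act m x.1, act_mem_coinv hH m x.1.2⟩ : M.coinv) ⊗ₜ[k] x.2 := by
    simp only [L, LinearMap.sum_apply]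
    rfl
  have h1 : L ∘ₗ TensorProduct.lift (actCoinv M) = LinearMap.id := by
    refine TensorProduct.ext' fun m a => ?_
    rw [LinearMap.comp_apply, TensorProduct.lift.tmul, actCoinv_apply, hL, LinearMap.id_apply]
    -- Each `a · qₓ` is coinvariant, hence a scalar, and can be moved across the tensor sign.
    have ha : a = ∑ x ∈ t, hco.equiv.symm ⟨_, starCanLin_mem hH a x.1.2⟩ • x.2 := by
      have : starCanLin k H A 1 a = a := by rw [starCanLin_one]; rfl
      conv_lhs => rw [← this, ← hz', map_sum, LinearMap.sum_apply]
      refine Finset.sum_congr rfl fun x _ => ?_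
      rw [starCanLin_mul_mk_counit, Algebra.smul_def, hco.algebraMap_equiv_symm]
    conv_rhs => rw [ha, TensorProduct.tmul_sum]
    refine Finset.sum_congr rfl fun x _ => ?_
    rw [← TensorProduct.smul_tmul]
    congr 1
    apply Subtype.ext
    change M.act (MulOpposite.op a • (m : M.carrier)) x.1 = _ • (m : M.carrier)
    rw [act_op_smul_of_mem_coinv m.2]
    have h2 := hco.algebraMap_equiv_symm ⟨_, starCanLin_mem hH a x.1.2⟩
    change _ = starCanLin k H A x.1 a at h2
    refine (congrArg (fun b => MulOpposite.op b • (m : M.carrier)) h2.symm).trans ?_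
    rw [Algebra.algebraMap_eq_smul_one, MulOpposite.op_smul, smul_assoc, MulOpposite.op_one,
      one_smul]
  refine Function.bijective_iff_has_inverse.2 ⟨L, LinearMap.congr_fun h1, fun m => ?_⟩
  change TensorProduct.lift (actCoinv M) (L m) = m
  rw [hL, map_sum]
  conv_rhs => rw [← M.act_one m, ← hz', map_sum]
  refine Finset.sum_congr rfl fun x _ => ?_
  rw [TensorProduct.lift.tmul, actCoinv_apply, act_mul_mk_counit]

theorem unit_bijective (hH : IsProgenerator k H) (hco : CoinvariantsEqBase k H A)
    (hA : Module.FaithfullyFlat k A) (hτ : Function.Surjective (tau (A := A) hH))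
    (N : ModuleCat.{u} k) : Function.Bijective ((adjunction k H A).unit.app N).hom := by
  constructor
  · rw [← LinearMap.ker_eq_bot, LinearMap.ker_eq_bot']
    intro n hn
    have h1 : n ⊗ₜ[k] (1 : A) = 0 := congrArg Subtype.val hn
    refine (Module.FaithfullyFlat.one_tmul_eq_zero_iff k N (A := A) n).1 ?_
    rw [← TensorProduct.comm_tmul, h1, map_zero]
  · rintro ⟨x, hx⟩
    obtain ⟨z, hz⟩ := hτ 1
    obtain ⟨t, rfl⟩ := BalancedTensor.exists_finset z
    have hz' : ∑ y ∈ t, starCanLin k H A y.2 y.1 = 1 := by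
      have := congrArg Subtype.val hz
      rw [map_sum, AddSubmonoidClass.coe_finsetSum] at this
      exact this
    -- On pure tensors the result is `n ⊗ ((c a) · y)`, and `(c a) · y` is a scalar because `y ∈ Q`.
    have key (x : N ⊗[k] A) (y : A × Q k H A) :
        ∃ n : N, (starCanLin k H A y.2).lTensor N ((LinearMap.mulRight k y.1).lTensor N x) =
          n ⊗ₜ[k] (1 : A) := by
      induction x with
      | zero => exact ⟨0, by simp⟩
      | add x x' hx hx' =>
        obtain ⟨n, hn⟩ := hx
        obtain ⟨n', hn'⟩ := hx'
        exact ⟨n + n', by rw [map_add, map_add, hn, hn', TensorProduct.add_tmul]⟩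
      | tmul n c =>
        refine ⟨hco.equiv.symm ⟨_, starCanLin_mem hH (c * y.1) y.2.2⟩ • n, ?_⟩
        rw [TensorProduct.smul_tmul, ← Algebra.algebraMap_eq_smul_one, hco.algebraMap_equiv_symm]
        simp
    choose n hn using key
    refine ⟨∑ y ∈ t, n x y, Subtype.ext ?_⟩
    change (∑ y ∈ t, n x y) ⊗ₜ[k] (1 : A) = x
    rw [TensorProduct.sum_tmul]
    -- From `1 = ∑ a · y` one gets `x = ∑ x (a · y) = ∑ (x a) · y` for coinvariant `x`; each term
    -- lies in `N ⊗ 1` by `key`.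
    have hx1 : x = ∑ y ∈ t, MulOpposite.op (starCanLin k H A y.2 y.1) • x := by
      rw [← Finset.sum_smul, ← Finset.op_sum, hz', MulOpposite.op_one, one_smul]
    conv_rhs => rw [hx1]
    refine Finset.sum_congr rfl fun y _ => ?_
    exact (hn x y).symm.trans ((induced_act (MulOpposite.op y.1 • x) y.2.1).symm.trans
      (act_op_smul_of_mem_coinv hx _ _))

theorem isIso_unit_counit (hH : IsProgenerator k H) (hco : CoinvariantsEqBase k H A)
    (hA : Module.FaithfullyFlat k A) (hτ : Function.Surjective (tau (A := A) hH))
    (hμ : Function.Surjective (mu k H A)) :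
    IsIso (adjunction k H A).unit ∧ IsIso (adjunction k H A).counit := by
  constructor
  · rw [NatTrans.isIso_iff_isIso_app]
    intro N
    exact (ConcreteCategory.isIso_iff_bijective _).2 (unit_bijective hH hco hA hτ N)
  · rw [NatTrans.isIso_iff_isIso_app]
    intro M
    exact isIso_of_bijective _ (counitHom_bijective hH hco hμ M)

end Equivalence

end RelHopfModule

end HopfGalois

namespace HopfGalois

namespace RelHopfModule

open CategoryTheory

/-! ### The smash product as a relative Hopf module -/

section SmashHopfModule

variable {k H A : Type u} [CommRing k] [Ring H] [Bialgebra k H] [Ring A]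
  [Algebra k A] [ComoduleAlgebra k H A]

/-- The inclusion of `A` into `H* # A`, `a ↦ ε # a`. -/
noncomputable def includeSmash (k H A : Type u) [CommRing k] [Ring H] [Bialgebra k H] [Ring A]
    [Algebra k A] [ComoduleAlgebra k H A] : A →+* Smash k H A where
  toFun := Smash.mk k Coalgebra.counit
  map_one' := rfl
  map_mul' _ _ := (mk_mul_mk_counit _ _ _).symm
  map_zero' := Smash.mk_zero _
  map_add' := Smash.mk_add _

/-- The coaction `y ↦ ∑ y (fᵢ # 1) ⊗ eᵢ` on `H* # A` attached to a dual basis of `H`. -/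
noncomputable def smashCoaction (k H A : Type u) [CommRing k] [Ring H] [Bialgebra k H] [Ring A]
    [Algebra k A] [ComoduleAlgebra k H A] {n : ℕ} (e : Fin n → H) (f : Fin n → Module.Dual k H) :
    Smash k H A →ₗ[k] Smash k H A ⊗[k] H :=
  ∑ i, (TensorProduct.mk k (Smash k H A) H).flip (e i) ∘ₗ
    LinearMap.mulRight k (Smash.mk k (f i) 1)

/-- The coaction is characterised by its slices `y (p # 1)`; all its axioms are verified through
them. -/
theorem rid_lTensor_smashCoaction {n : ℕ} {e : Fin n → H} {f : Fin n → Module.Dual k H}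
    (hef : ∀ x, ∑ i, f i x • e i = x) (y : Smash k H A) (p : Module.Dual k H) :
    TensorProduct.rid k (Smash k H A)
      (LinearMap.lTensor (Smash k H A) p (smashCoaction k H A e f y)) = y * Smash.mk k p 1 := by
  have hp : p = ∑ i, p (e i) • f i := by
    ext x
    conv_lhs => rw [← hef x]
    simp [mul_comm]
  conv_rhs => rw [hp]
  simp [smashCoaction, Smash.sum_mk, Smash.smul_mk, Finset.mul_sum]

/-- The relative Hopf module structure on `H* # A`, with `y a = y (ε # a)` and the coaction that
corresponds to the right action of `H*`. -/
noncomputable def smash {n : ℕ} {e : Fin n → H} {f : Fin n → Module.Dual k H}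
    (hef : ∀ x, ∑ i, f i x • e i = x) : RelHopfModule k H A :=
  letI : Module Aᵐᵒᵖ (Smash k H A) := Module.compHom _ (includeSmash k H A).op
  haveI : IsScalarTower k Aᵐᵒᵖ (Smash k H A) := ⟨fun c a y => by
    change y * Smash.mk k Coalgebra.counit (c • a.unop) =
      c • (y * Smash.mk k Coalgebra.counit a.unop)
    rw [Smash.mk_smul, mul_smul_comm]⟩
  have hH : Module.Finite k H ∧ Module.Projective k H := finite_projective_of_dual_basis e f hef
  haveI := hH.1
  haveI := hH.2
  { carrier := Smash k H A
    coaction := smashCoaction k H A e f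
    coassoc := fun y => by
      rw [← LinearEquiv.eq_symm_apply]
      -- After slicing, coassociativity is `y (q # 1) (p # 1) = y ((p * q) # 1)`.
      refine tensor_ext_dual fun q => tensor_ext_dual fun p => ?_
      have e1 (z : Smash k H A ⊗[k] H) : TensorProduct.rid k (Smash k H A ⊗[k] H)
          (LinearMap.lTensor _ q ((smashCoaction k H A e f).rTensor H z)) =
          smashCoaction k H A e f (TensorProduct.rid k _ (LinearMap.lTensor _ q z)) := by
        induction z with
        | zero => simp
        | add x y hx hy => simp only [map_add, hx, hy]
        | tmul m h => simp
      have e2 (z : Smash k H A ⊗[k] H) : TensorProduct.rid k (Smash k H A)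
          (LinearMap.lTensor (Smash k H A) p (TensorProduct.rid k (Smash k H A ⊗[k] H)
            (LinearMap.lTensor _ q ((TensorProduct.assoc k (Smash k H A) H H).symm
              (Coalgebra.comul.lTensor (Smash k H A) z))))) =
          TensorProduct.rid k _ (LinearMap.lTensor _ (conv k H p q) z) := by
        induction z with
        | zero => simp
        | add x y hx hy => simp only [map_add, hx, hy]
        | tmul m h =>
          simp only [LinearMap.lTensor_tmul, TensorProduct.rid_tmul, conv_apply]
          generalize (Coalgebra.comul h : H ⊗[k] H) = d
          induction d with
          | zero => simp
          | add x y hx hy => simp only [TensorProduct.tmul_add, map_add, add_smul, hx, hy]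
          | tmul h h' => simp [mul_comm, mul_smul]
      rw [e1, e2, rid_lTensor_smashCoaction hef, rid_lTensor_smashCoaction hef,
        rid_lTensor_smashCoaction hef, mul_assoc, mk_one_mul_mk_one]
    counit_coaction := fun y =>
      (rid_lTensor_smashCoaction hef y Coalgebra.counit).trans (mul_one y)
    coaction_smul := fun y a => by
      refine tensor_ext_dual fun p => ?_
      rw [rid_lTensor_smashCoaction hef]
      change y * Smash.mk k Coalgebra.counit a * Smash.mk k p 1 = _
      rw [mul_assoc, mk_counit_mul]
      generalize rho k H A a = t
      induction t with
      | zero => simp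
      | add t t' ht ht' => simp only [map_add, LinearMap.add_apply, mul_add, ht, ht']
      | tmul b g =>
        rw [twist_tmul_mk, mul_one, ← mk_counit_mul_mk, ← mul_assoc,
          ← rid_lTensor_smashCoaction hef]
        generalize smashCoaction k H A e f y = z
        induction z with
        | zero => simp
        | add z z' hz hz' => simp only [map_add, LinearMap.add_apply, add_mul, hz, hz']
        | tmul m h =>
          simp only [LinearMap.lTensor_tmul, TensorProduct.rid_tmul, trans_apply,
            TensorProduct.map₂_apply_tmul, smul_mul_assoc]
          rfl }

/-- Slicing `ρ(y) = y ⊗ 1` along `p` gives the relation defining `Q`. -/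
theorem smash_coinv_le {n : ℕ} {e : Fin n → H} {f : Fin n → Module.Dual k H}
    (hef : ∀ x, ∑ i, f i x • e i = x) {y : Smash k H A} (hy : y ∈ (smash hef).coinv) :
    y ∈ Q k H A := by
  refine mem_Q.2 fun p => ?_
  have hy' : smashCoaction k H A e f y = y ⊗ₜ[k] (1 : H) := hy
  rw [← rid_lTensor_smashCoaction hef, hy', LinearMap.lTensor_tmul, TensorProduct.rid_tmul]

/-- On `H* # A` the counit is `y ⊗ a ↦ y (ε # a)` with `y` coinvariant, so its image lies in that of
`μ`. -/
theorem mu_surjective_of_isIso_counit (hH : IsProgenerator k H)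
    (h : IsIso (adjunction k H A).counit) : Function.Surjective (mu k H A) := by
  have := hH.finite
  have := hH.projective
  obtain ⟨n, e, f, hef⟩ := exists_dual_basis (k := k) H
  intro y
  let c := (adjunction k H A).counit.app (smash hef)
  have hc : Hom.toLinearMap c (Hom.toLinearMap (inv c) y) = y :=
    LinearMap.congr_fun (congrArg Hom.toLinearMap (IsIso.inv_hom_id c)) y
  have hmem (z : (smash (A := A) hef).coinv ⊗[k] A) :
      TensorProduct.lift (actCoinv (smash hef)) z ∈ LinearMap.range (mu k H A) := by
    induction z with
    | zero => exact ⟨0, by rw [map_zero, map_zero]; rfl⟩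
    | add x x' hx hx' =>
      obtain ⟨w, hw⟩ := hx
      obtain ⟨w', hw'⟩ := hx'
      exact ⟨w + w', by rw [map_add, map_add, hw, hw']; rfl⟩
    | tmul m a => exact ⟨⟨m.1, smash_coinv_le hef m.2⟩ ⊗ₜ a, rfl⟩
  obtain ⟨w, hw⟩ := hmem (Hom.toLinearMap (inv c) y)
  exact ⟨w, hw.trans hc⟩

end SmashHopfModule

end RelHopfModule

end HopfGalois

/-- For a Hopf algebra `H` that is a `k`-progenerator and a right `H`-comodule algebra `A`, four
characterisations of `A` being an `H`-Galois extension of `k`. -/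
theorem proposition5p7 {k H A : Type u} [CommRing k] [Ring H] [HopfAlgebra k H] [Ring A]
    [Algebra k A] [HopfGalois.ComoduleAlgebra k H A] (hH : HopfGalois.IsProgenerator k H) :
    List.TFAE [
      Function.Bijective (HopfGalois.can k H A) ∧ Module.FaithfullyFlat k A,
      Function.Bijective (HopfGalois.starCan k H A) ∧ HopfGalois.IsProgenerator k A,
      ∃ h : HopfGalois.CoinvariantsEqBase k H A, (HopfGalois.moritaContext hH h).IsStrict,
      HopfGalois.CoinvariantsEqBase k H A ∧
        CategoryTheory.IsIso (HopfGalois.RelHopfModule.adjunction k H A).unit ∧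
        CategoryTheory.IsIso (HopfGalois.RelHopfModule.adjunction k H A).counit] := by
  rw [HopfGalois.bijective_starCan_iff]
  tfae_have 1 → 2 := fun ⟨h, hA⟩ =>
    ⟨HopfGalois.bijective_starCanLin_of_bijective_can hH h,
      HopfGalois.isProgenerator_of_bijective_can hH h hA⟩
  tfae_have 2 → 1 := fun ⟨h, hA⟩ =>
    ⟨HopfGalois.bijective_can_of_bijective_starCanLin hH hA h, hA.faithfullyFlat⟩
  tfae_have 2 → 3 := fun ⟨h, hA⟩ =>
    ⟨HopfGalois.coinvariantsEqBase_of_surjective hA h.2,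
      HopfGalois.moritaContext_isStrict hH hA h _⟩
  tfae_have 3 → 4 := fun ⟨hco, hτ, hμ⟩ => by
    have hA := (HopfGalois.bijective_starCanLin_of_mu_surjective hH hco hμ.2).2
    refine ⟨hco, HopfGalois.RelHopfModule.isIso_unit_counit hH hco hA.faithfullyFlat ?_ hμ.2⟩
    -- The map `τ` of the context is `tau` followed by the identification of `A^{co H}` with `k`,
    -- which is undone here.
    intro b
    obtain ⟨z, hz⟩ := hτ.2 (hco.equiv.symm b)
    exact ⟨z, hco.equiv.symm.injective hz⟩
  tfae_have 4 → 2 := fun ⟨hco, _, h⟩ =>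
    HopfGalois.bijective_starCanLin_of_mu_surjective hH hco
      (HopfGalois.RelHopfModule.mu_surjective_of_isIso_counit hH h)
  tfae_finish
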